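/- A \emph{rhombus shape} is a pair $(\vec u,\vec v)$ of linearly independent vectors of equal length in the Euclidean plane; placed at $p\in\mathbb R^2$ it is the rhombus $\{p+a\vec u+b\vec v : a,b\in[0,1]\}$. A \emph{shapeset} $\mathcal T$ is a finite family of rhombus shapes. A set of translates of shapes of $\mathcal T$ is \emph{edge-to-edge} if any two distinct members are disjoint, or meet exactly in one common vertex, or meet exactly in one full common edge. A \emph{$\mathcal T$-tiling} is an edge-to-edge set of translates that covers the plane; a \emph{patch} is a finite edge-to-edge set of translates whose union is simply connected; a \emph{pattern} is a patch up to translation, and it \emph{appears} in a tiling if some translate of the patch is contained in the tiling. Patterns are encoded by finite lists of (index of a shape, integer coordinates of its position with respect to the edge vectors of the shapes of $\mathcal T$). Let $\mathcal F$ be a computable enumeration of (finitely or infinitely many, possibly no) patterns, and let $X$ be the subshift of all $\mathcal T$-tilings in which no pattern of $\mathcal F$ appears. The problem $\mathrm{Domino}\text{-}X$ is the following. Input: a finite set $\mathbf T$ of $\mathcal T$-Wang tiles, that is, of shapes of $\mathcal T$ with a colour (a natural number) on each of the four edges. Question: is there a set $x$ of translates of tiles of $\mathbf T$ whose colour-erased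 set $\pi(x)$ is a $\mathcal T$-tiling belonging to $X$ and in which any two tiles that share an edge have the same colour on this edge? \textbf{Proposition.} For every shapeset $\mathcal T$ and every subshift $X$ on $\mathcal T$ defined in this way by a computable enumeration of forbidden patterns, $\mathrm{Domino}\text{-}X$ is co-computably enumerable ($\Pi^0_1$): there is a total computable function $f$ with values in $\{0,1\}$ such that, for every input $\mathbf T$, $\mathrm{Domino}\text{-}X$ holds for $\mathbf T$ if and only if $f(\mathbf T,n)=1$ for all $n\in\mathbb N$. -/

import Mathlib

open Set

namespace RhombusTiling

/-- The Euclidean plane. -/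
abbrev Plane : Type := EuclideanSpace ℝ (Fin 2)

/-- A rhombus shape up to translation: two linearly independent vectors of equal length. -/
structure Shape where
  u : Plane
  v : Plane
  norm_eq : ‖u‖ = ‖v‖
  indep : LinearIndependent ℝ ![u, v]

/-- A shapeset: a finite (indexed) family of rhombus shapes up to translation. -/
abbrev ShapeSet (n : ℕ) : Type := Fin n → Shape

/-- A translate of a shape of the shapeset: the index of the shape and the position `p`. -/
abbrev PlacedShape (n : ℕ) : Type := Fin n × Plane

section Geometry

variable {n : ℕ} (S : ShapeSet n)

/-- The rhombus `{p + a u + b v : a, b ∈ [0,1]}` occupied by a placed shape. -/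
def support (t : PlacedShape n) : Set Plane :=
  {x | ∃ a ∈ Icc (0 : ℝ) 1, ∃ b ∈ Icc (0 : ℝ) 1, x = t.2 + a • (S t.1).u + b • (S t.1).v}

/-- The four vertices `p`, `p + u`, `p + u + v`, `p + v`, in cyclic order. -/
def vertex (t : PlacedShape n) : Fin 4 → Plane :=
  ![t.2, t.2 + (S t.1).u, t.2 + (S t.1).u + (S t.1).v, t.2 + (S t.1).v]

/-- The `k`-th side joins the `k`-th vertex to the next one (cyclically, `k + 1` modulo 4). -/
def edge (t : PlacedShape n) (k : Fin 4) : Set Plane :=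
  segment ℝ (vertex S t k) (vertex S t (k + 1))

/-- Two placed shapes are disjoint, or meet exactly in a common vertex, or meet exactly in a
full common edge. -/
def MeetEdgeToEdge (t t' : PlacedShape n) : Prop :=
  support S t ∩ support S t' = ∅ ∨
  (∃ k l : Fin 4, vertex S t k = vertex S t' l ∧
    support S t ∩ support S t' = {vertex S t k}) ∨
  (∃ k l : Fin 4, edge S t k = edge S t' l ∧
    support S t ∩ support S t' = edge S t k)

/-- The union of the rhombuses of a set of placed shapes. -/
def setSupport (P : Set (PlacedShape n)) : Set Plane := ⋃ t ∈ P, support S t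

/-- A patch: a finite edge-to-edge set of placed shapes whose support is simply connected. -/
def IsPatch (P : Set (PlacedShape n)) : Prop :=
  P.Finite ∧ P.Pairwise (MeetEdgeToEdge S) ∧ SimplyConnectedSpace (setSupport S P)

/-- A tiling: an edge-to-edge covering of the plane by translates of the shapes. -/
def IsTiling (x : Set (PlacedShape n)) : Prop :=
  setSupport S x = univ ∧ x.Pairwise (MeetEdgeToEdge S)

/-- The full shift: all tilings by the given shapes. -/
def fullShift : Set (Set (PlacedShape n)) := {x | IsTiling S x}

/-- The pattern of `P` (the class of `P` up to translation) appears in `x`: some translate of `P`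
is contained in `x`. -/
def Appears (P x : Set (PlacedShape n)) : Prop :=
  ∃ d : Plane, ∀ t ∈ P, (t.1, t.2 + d) ∈ x

end Geometry

/-- Finite descriptions of patterns: a list of tiles, each one given by the index of its shape and
by the integer coordinates of its position with respect to the edge vectors of the shapeset. (Two
tiles that share a vertex have positions that differ by an integer combination of edge vectors, so
that every patch has, up to translation, such a description.) -/
abbrev PatternCode (n : ℕ) : Type := List (Fin n × (Fin n → ℤ × ℤ))

/-- The point of the plane with the given integer coordinates. -/
noncomputable def point {n : ℕ} (S : ShapeSet n) (c : Fin n → ℤ × ℤ) : Plane :=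
  ∑ j, ((c j).1 • (S j).u + (c j).2 • (S j).v)

/-- The set of placed shapes described by a code. -/
def PatternCode.decode {n : ℕ} (S : ShapeSet n) (P : PatternCode n) : Set (PlacedShape n) :=
  {t | ∃ e ∈ P, t = (e.1, point S e.2)}

/-- The set of all tilings in which none of the enumerated patterns appears. The value `none` at
step `k` means that no pattern is listed at that step, so that finite (or empty) lists of forbidden
patterns are included. -/
def avoiding {n : ℕ} (S : ShapeSet n) (F : ℕ → Option (PatternCode n)) :
    Set (Set (PlacedShape n)) :=
  {x | x ∈ fullShift S ∧ ∀ k, ∀ P ∈ F k, ¬ Appears (P.decode S) x}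

/-- `X` is the subshift defined by some computable enumeration of forbidden patterns. -/
def IsEffectiveSubshift {n : ℕ} (S : ShapeSet n) (X : Set (Set (PlacedShape n))) : Prop :=
  ∃ F : ℕ → Option (PatternCode n),
    Computable F ∧ (∀ k, ∀ P ∈ F k, IsPatch S (P.decode S)) ∧ X = avoiding S F

/-- A Wang tile `(r, a₀, a₁, a₂, a₃)`: a shape of the shapeset and a colour (a natural number) on
each of its four sides. -/
abbrev WangTile (n : ℕ) : Type := Fin n × (Fin 4 → ℕ)

/-- A translate of a Wang tile. -/
abbrev PlacedWangTile (n : ℕ) : Type := WangTile n × Plane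

/-- Colour erasing. -/
def erase {n : ℕ} (t : PlacedWangTile n) : PlacedShape n := (t.1.1, t.2)

/-- The tilings by (translates of) the Wang tiles of `T`: the colour-erased set is a tiling, and
tiles that share an edge have the same colour on it. -/
def wangShift {n : ℕ} (S : ShapeSet n) (T : List (WangTile n)) : Set (Set (PlacedWangTile n)) :=
  {x | (∀ t ∈ x, t.1 ∈ T) ∧ erase '' x ∈ fullShift S ∧
    ∀ t ∈ x, ∀ t' ∈ x, ∀ k l : Fin 4,
      edge S (erase t) k = edge S (erase t') l → t.1.2 k = t'.1.2 l}

/-- The Domino problem on `X`: the input is a finite set of Wang tiles, given as a list. -/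
def Domino {n : ℕ} (S : ShapeSet n) (X : Set (Set (PlacedShape n))) (T : List (WangTile n)) :
    Prop :=
  ∃ x ∈ wangShift S T, erase '' x ∈ X

/-- Co-computably enumerable (`Π⁰₁`) decision problems. -/
def IsCoComputablyEnumerable {α : Type*} [Primcodable α] (A : α → Prop) : Prop :=
  ∃ f : α → ℕ → Bool, Computable₂ f ∧ ∀ a, A a ↔ ∀ k, f a k = true

end RhombusTiling

/-! ### Primitive recursion on powers and binary digits -/

namespace RhombusTiling

/-! The existence of a coloured tiling is equivalent to the satisfiability of a computable family of
finite clauses. By compactness, unsatisfiability shows on a finite part of the family, and every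
finite part can be tested by brute force; hence the problem is co-c.e. The variables say which
shapes and which Wang tiles sit at which integer combinations of the edge vectors.

The edge vectors are arbitrary reals, so no geometric predicate is computed. Only finitely many
geometric facts are used: which sets of neighbours surround a tile, which tiles a bounded number of
steps apart meet badly, which sides coincide, and generators of the integer relations between edge
vectors. They depend on the shapeset alone and enter the algorithm as constants (`ClauseData`,
`clauseData`).

A tiling yields a satisfying assignment by reading off its tiles (`exists_satisfies_of_domino`). The
converse is the delicate point: the positions form a finitely generated subgroup of the plane that
may be dense, and the exclusions reach only six steps, so an assignment may superpose many tilings.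
Locally, however, the tiles declared present behave like a covering of the plane. Since the plane
has no monodromy, a single sheet can be selected (`exists_sheet`), and this sheet is a tiling.
Colour and pattern constraints hold for all tiles declared present, hence on the sheet. -/

theorem primrec₂_nat_pow : Primrec₂ ((· ^ ·) : ℕ → ℕ → ℕ) :=
  Primrec₂.unpaired'.1 Nat.Primrec.pow

theorem primrec₂_testBit : Primrec₂ Nat.testBit := by
  have h : Primrec₂ fun m i : ℕ => decide (m / 2 ^ i % 2 = 1) :=
    PrimrecPred.decide <| Primrec.eq.comp
      (Primrec.nat_mod.comp (Primrec.nat_div.comp Primrec.fst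
        (primrec₂_nat_pow.comp (Primrec.const 2) Primrec.snd)) (Primrec.const 2))
      (Primrec.const 1)
  exact h.of_eq fun m i => (Nat.testBit_eq_decide_div_mod_eq).symm

/-! ### Compactness for computable families of clauses -/

section Clauses

variable {α ι β : Type*} [Primcodable α] [Primcodable ι] [Primcodable β]

/-- A finite list of clauses can be satisfied by an assignment of the variables with codes below
`N`, all literals in the other variables being regarded as true. -/
def BoundedSat (L : List (List (β × Bool))) (N : ℕ) : Prop :=
  ∃ m < 2 ^ N, ∀ cl ∈ L, ∃ l ∈ cl,
    N ≤ Encodable.encode l.1 ∨ m.testBit (Encodable.encode l.1) = l.2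

theorem primrecRel_boundedSat : PrimrecRel (BoundedSat (β := β)) := by
  have h1 : PrimrecRel fun (l : β × Bool) (p : ℕ × ℕ) =>
      p.2 ≤ Encodable.encode l.1 ∨ p.1.testBit (Encodable.encode l.1) = l.2 :=
    PrimrecPred.or
      (Primrec.nat_le.comp (Primrec.snd.comp Primrec.snd)
        (Primrec.encode.comp (Primrec.fst.comp Primrec.fst)))
      (Primrec.eq.comp
        (primrec₂_testBit.comp (Primrec.fst.comp Primrec.snd)
          (Primrec.encode.comp (Primrec.fst.comp Primrec.fst)))
        (Primrec.snd.comp Primrec.fst))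
  have h2 := h1.exists_mem_list.forall_mem_list
  have h3 : PrimrecRel fun (m : ℕ) (p : List (List (β × Bool)) × ℕ) =>
      ∀ cl ∈ p.1, ∃ l ∈ cl,
        p.2 ≤ Encodable.encode l.1 ∨ m.testBit (Encodable.encode l.1) = l.2 :=
    h2.comp (Primrec.fst.comp Primrec.snd)
      (Primrec.pair Primrec.fst (Primrec.snd.comp Primrec.snd))
  have h4 : PrimrecRel fun (L : List (List (β × Bool))) (N : ℕ) =>
      ∃ m ∈ List.range (2 ^ N), ∀ cl ∈ L, ∃ l ∈ cl,
        N ≤ Encodable.encode l.1 ∨ m.testBit (Encodable.encode l.1) = l.2 :=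
    h3.exists_mem_list.comp
      (Primrec.list_range.comp (primrec₂_nat_pow.comp (Primrec.const 2) Primrec.snd)) Primrec.id
  exact h4.of_eq fun L N => by simp only [BoundedSat, List.mem_range]

/-- Compactness: the bounded solutions `m N` are replaced by their limit along a nonprincipal
ultrafilter. For large `N` all variables of a given clause have codes below `N`, so a true literal
is a genuine one. A clause has finitely many literals, so one of them holds for almost all `N`. -/
theorem exists_assignment_iff_forall_boundedSat (C : ℕ → List (List (β × Bool))) :
    (∃ v : β → Bool, ∀ k, ∀ cl ∈ C k, ∃ l ∈ cl, v l.1 = l.2) ↔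
      ∀ N, BoundedSat ((List.range N).flatMap C) N := by
  constructor
  · rintro ⟨v, hv⟩ N
    let w : Fin N → Bool := fun i => ((Encodable.decode (α := β) i).map v).getD false
    refine ⟨Nat.ofBits w, Nat.ofBits_lt_two_pow w, fun cl hcl => ?_⟩
    obtain ⟨k, -, hk⟩ := List.mem_flatMap.1 hcl
    obtain ⟨l, hl, hvl⟩ := hv k cl hk
    refine ⟨l, hl, ?_⟩
    by_cases h : N ≤ Encodable.encode l.1
    · exact Or.inl h
    · right
      rw [Nat.testBit_ofBits_lt w _ (not_le.1 h)]
      simp [w, hvl]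
  · intro h
    choose m _ hm using h
    classical
    let 𝒰 := Filter.hyperfilter ℕ
    refine ⟨fun b => decide (∀ᶠ N in 𝒰, (m N).testBit (Encodable.encode b) = true),
      fun k cl hcl => ?_⟩
    have hlarge : ∀ N₀ : ℕ, ∀ᶠ N in (𝒰 : Filter ℕ), N₀ < N := fun N₀ =>
      Nat.hyperfilter_le_atTop (Filter.eventually_gt_atTop N₀)
    have hev : ∀ᶠ N in (𝒰 : Filter ℕ),
        ∃ l ∈ cl.toFinset, (m N).testBit (Encodable.encode l.1) = l.2 := by
      filter_upwards [hlarge k,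
        hlarge (cl.toFinset.sup fun l => Encodable.encode l.1)] with N hk hN
      obtain ⟨l, hl, hlN⟩ := hm N cl (List.mem_flatMap.2 ⟨k, List.mem_range.2 hk, hcl⟩)
      refine ⟨l, List.mem_toFinset.2 hl, hlN.resolve_left fun hle => ?_⟩
      have := Finset.le_sup (f := fun l : β × Bool => Encodable.encode l.1)
        (List.mem_toFinset.2 hl)
      omega
    have hex : ∃ l ∈ cl.toFinset,
        ∀ᶠ N in (𝒰 : Filter ℕ), (m N).testBit (Encodable.encode l.1) = l.2 :=
      (Ultrafilter.eventually_exists_mem_iff cl.toFinset.finite_toSet).1 hev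
    obtain ⟨⟨b, c⟩, hl, hlev⟩ := hex
    refine ⟨(b, c), List.mem_toFinset.1 hl, ?_⟩
    cases c with
    | true => simpa using hlev
    | false =>
      simp only [decide_eq_false_iff_not]
      intro h'
      obtain ⟨N, h1, h2⟩ := (hlev.and h').exists
      simp_all

/-- Satisfiability of a computable family of finite lists of clauses is a `Π⁰₁` problem. -/
theorem isCoComputablyEnumerable_exists_assignment (C : α → ι → List (List (β × Bool)))
    (hC : Computable₂ C) :
    IsCoComputablyEnumerable fun a =>
      ∃ v : β → Bool, ∀ i, ∀ cl ∈ C a i, ∃ l ∈ cl, v l.1 = l.2 := by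
  classical
  -- Numbers that code no index contribute no clause.
  let C' : α → ℕ → List (List (β × Bool)) := fun a k =>
    Option.casesOn (Encodable.decode (α := ι) k) [] fun i => C a i
  have hC' : Computable₂ C' :=
    Computable.option_casesOn (Computable.decode.comp Computable.snd) (Computable.const [])
      (hC.comp (Computable.fst.comp Computable.fst) Computable.snd)
  let P : α → ℕ → List (List (β × Bool)) := fun a N => (List.range N).flatMap (C' a)
  have hP : Computable₂ P := by
    have hstep : Computable₂ fun (p : α × ℕ) (q : ℕ × List (List (β × Bool))) =>
        q.2 ++ C' p.1 q.1 :=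
      Primrec.list_append.to_comp.comp (Computable.snd.comp Computable.snd)
        (hC'.comp (Computable.fst.comp Computable.fst) (Computable.fst.comp Computable.snd))
    have hrec := Computable.nat_rec (f := fun p : α × ℕ => p.2) Computable.snd
      (Computable.const []) hstep
    refine hrec.of_eq fun ⟨a, N⟩ => ?_
    change _ = (List.range N).flatMap (C' a)
    dsimp only
    induction N with
    | zero => rfl
    | succ N ih =>
      rw [List.range_succ, List.flatMap_append, ← ih, List.flatMap_singleton]
  refine ⟨fun a N => decide (BoundedSat (P a N) N), ?_, fun a => ?_⟩
  · exact primrecRel_boundedSat.decide.to_comp.comp hP Computable.snd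
  · simp only [decide_eq_true_eq]
    rw [← exists_assignment_iff_forall_boundedSat (C' a)]
    refine exists_congr fun v => ⟨fun h k cl hcl => ?_, fun h i cl hcl => ?_⟩
    · cases hk : (Encodable.decode k : Option ι) with
      | none => simp [C', hk] at hcl
      | some i => exact h i cl (by simpa [C', hk] using hcl)
    · exact h (Encodable.encode i) cl (by simpa [C'] using hcl)

end Clauses

/-! ### Computable addition of integer coordinates -/

theorem primrec_int_toNat : Primrec Int.toNat := by
  have h : Primrec fun z : ℤ =>
      if (Encodable.encode z) % 2 = 0 then (Encodable.encode z) / 2 else 0 :=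
    Primrec.ite (Primrec.eq.comp (Primrec.nat_mod.comp Primrec.encode (Primrec.const 2))
      (Primrec.const 0)) (Primrec.nat_div.comp Primrec.encode (Primrec.const 2)) (Primrec.const 0)
  refine h.of_eq fun z => ?_
  cases z with
  | ofNat m =>
    have : Encodable.encode (Int.ofNat m) = 2 * m := rfl
    rw [this]
    simp
  | negSucc m =>
    have : Encodable.encode (Int.negSucc m) = 2 * m + 1 := rfl
    rw [this]
    simp [Nat.add_mod]

theorem primrec_int_neg_toNat : Primrec fun z : ℤ => (-z).toNat := by
  have h : Primrec fun z : ℤ =>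
      if (Encodable.encode z) % 2 = 0 then 0 else (Encodable.encode z) / 2 + 1 :=
    Primrec.ite (Primrec.eq.comp (Primrec.nat_mod.comp Primrec.encode (Primrec.const 2))
      (Primrec.const 0)) (Primrec.const 0)
      (Primrec.succ.comp (Primrec.nat_div.comp Primrec.encode (Primrec.const 2)))
  refine h.of_eq fun z => ?_
  cases z with
  | ofNat m =>
    have : Encodable.encode (Int.ofNat m) = 2 * m := rfl
    rw [this]
    simp
  | negSucc m =>
    have : Encodable.encode (Int.negSucc m) = 2 * m + 1 := rfl
    rw [this, Int.neg_negSucc]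
    have h1 : (2 * m + 1) % 2 = 1 := by omega
    have h2 : (2 * m + 1) / 2 = m := by omega
    simp [h1, h2]

theorem primrec₂_subNatNat : Primrec₂ Int.subNatNat := by
  refine Primrec₂.encode_iff.1 ?_
  have h : Primrec₂ fun a b : ℕ => if b ≤ a then 2 * (a - b) else 2 * (b - a).pred + 1 :=
    Primrec.ite (Primrec.nat_le.comp Primrec.snd Primrec.fst)
      (Primrec.nat_double.comp (Primrec.nat_sub.comp Primrec.fst Primrec.snd))
      (Primrec.nat_double_succ.comp
        (Primrec.pred.comp (Primrec.nat_sub.comp Primrec.snd Primrec.fst)))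
  refine h.of_eq fun a b => ?_
  split_ifs with hab
  · rw [Int.subNatNat_of_le hab]
    rfl
  · rw [Int.subNatNat_of_lt (not_le.1 hab)]
    rfl

theorem primrec₂_int_add : Primrec₂ ((· + ·) : ℤ → ℤ → ℤ) := by
  have h : Primrec₂ fun a b : ℤ =>
      Int.subNatNat (a.toNat + b.toNat) ((-a).toNat + (-b).toNat) :=
    primrec₂_subNatNat.comp
      (Primrec.nat_add.comp (primrec_int_toNat.comp Primrec.fst)
        (primrec_int_toNat.comp Primrec.snd))
      (Primrec.nat_add.comp (primrec_int_neg_toNat.comp Primrec.fst)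
        (primrec_int_neg_toNat.comp Primrec.snd))
  refine h.of_eq fun a b => ?_
  rw [Int.subNatNat_eq_coe]
  push_cast
  omega

/-- Integer coordinates with respect to the edge vectors of a shapeset of `n` shapes. -/
abbrev Coord (n : ℕ) : Type := Fin n → ℤ × ℤ

theorem primrec₂_coord_add {n : ℕ} : Primrec₂ ((· + ·) : Coord n → Coord n → Coord n) := by
  have happ : Primrec₂ fun (c : Coord n) (i : Fin n) => c i := Primrec.fin_app
  have h1 := happ.comp (Primrec.fst.comp (Primrec.fst (α := Coord n × Coord n) (β := Fin n)))
    Primrec.snd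
  have h2 := happ.comp (Primrec.snd.comp (Primrec.fst (α := Coord n × Coord n) (β := Fin n)))
    Primrec.snd
  have h : Primrec₂ fun (p : Coord n × Coord n) (i : Fin n) =>
      ((p.1 i).1 + (p.2 i).1, (p.1 i).2 + (p.2 i).2) :=
    Primrec.pair
      (primrec₂_int_add.comp (Primrec.fst.comp h1) (Primrec.fst.comp h2))
      (primrec₂_int_add.comp (Primrec.snd.comp h1) (Primrec.snd.comp h2))
  exact (Primrec.fin_curry.2 h).of_eq fun p => rfl

/-! ### The clauses and their computability -/

/-- The propositional variables: `(Sum.inl s, c)` says that the shape `s` is placed at the point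
with coordinates `c`, and `(Sum.inr w, c)` that the Wang tile `w` is placed there. -/
abbrev Var (n : ℕ) : Type := (Fin n ⊕ WangTile n) × Coord n

/-- The finite data, depending only on the shapeset, from which the clauses are built. -/
structure ClauseData (n : ℕ) where
  /-- `(s, L)`: a tile of shape `s` forces one of the tiles of `L` in relative position. -/
  forced : List (Fin n × List (Fin n × Coord n))
  /-- `(s, s', d)`: tiles of shapes `s` and `s'` are not allowed in relative position `d`. -/
  excluded : List (Fin n × Fin n × Coord n)
  /-- `((s, k), (s', l), d)`: side `k` of `s` is side `l` of `s'` placed in relative position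
  `d`. -/
  glued : List ((Fin n × Fin 4) × (Fin n × Fin 4) × Coord n)
  /-- Displacements whose coordinates describe the origin. -/
  periods : List (Coord n)

namespace ClauseData

variable {n : ℕ} (D : ClauseData n)

/-- The clauses attached to the coordinates `c` and to the forbidden pattern `P`. -/
def clauses (T : List (WangTile n)) (c : Coord n) (P : Option (PatternCode n)) :
    List (List (Var n × Bool)) :=
  [(List.finRange n).map fun s => ((Sum.inl s, 0), true)] ++
  (D.forced.map fun h =>
    ((Sum.inl h.1, c), false) :: h.2.map fun e => ((Sum.inl e.1, c + e.2), true)) ++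
  (D.excluded.map fun b => [((Sum.inl b.1, c), false), ((Sum.inl b.2.1, c + b.2.2), false)]) ++
  ((List.finRange n).map fun s => ((Sum.inl s, c), false) ::
    T.flatMap fun w => if w.1 = s then [((Sum.inr w, c), true)] else []) ++
  (D.glued.flatMap fun e => T.flatMap fun w => T.flatMap fun w' =>
    if w.1 = e.1.1 ∧ w'.1 = e.2.1.1 ∧ ¬ w.2 e.1.2 = w'.2 e.2.1.2 then
      [[((Sum.inr w, c), false), ((Sum.inr w', c + e.2.2), false)]] else []) ++
  (T.flatMap fun w => D.periods.map fun κ =>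
    [((Sum.inr w, c), false), ((Sum.inr w, c + κ), true)]) ++
  (P.toList.map fun P => P.map fun e => ((Sum.inl e.1, c + e.2), false))

theorem primrec_clauses : Primrec fun p : (List (WangTile n) × Coord n) × Option (PatternCode n) =>
    D.clauses p.1.1 p.1.2 p.2 := by
  have hlit : ∀ {α : Type} [Primcodable α] {f : α → Fin n ⊕ WangTile n} {g : α → Coord n}
      (b : Bool), Primrec f → Primrec g → Primrec fun a => (((f a, g a), b) : Var n × Bool) :=
    fun b hf hg => (hf.pair hg).pair (Primrec.const b)
  have hsingle : ∀ {α β : Type} [Primcodable α] [Primcodable β] {f : α → β},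
      Primrec f → Primrec fun a => [f a] := fun hf => Primrec.list_cons.comp hf (Primrec.const [])
  have hpair : ∀ {α β : Type} [Primcodable α] [Primcodable β] {f g : α → β},
      Primrec f → Primrec g → Primrec fun a => [f a, g a] :=
    fun hf hg => Primrec.list_cons.comp hf (Primrec.list_cons.comp hg (Primrec.const []))
  have hT : Primrec fun p : (List (WangTile n) × Coord n) × Option (PatternCode n) => p.1.1 :=
    Primrec.fst.comp Primrec.fst
  have hc : Primrec fun p : (List (WangTile n) × Coord n) × Option (PatternCode n) => p.1.2 :=
    Primrec.snd.comp Primrec.fst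
  refine Primrec.list_append.comp (Primrec.list_append.comp (Primrec.list_append.comp
    (Primrec.list_append.comp (Primrec.list_append.comp (Primrec.list_append.comp ?_ ?_) ?_) ?_)
    ?_) ?_) ?_
  · exact Primrec.const _
  · refine Primrec.list_map (Primrec.const _) (Primrec.list_cons.comp ?_ ?_)
    · exact hlit _ (Primrec.sumInl.comp (Primrec.fst.comp Primrec.snd)) (hc.comp Primrec.fst)
    · refine Primrec.list_map (Primrec.snd.comp Primrec.snd) ?_
      exact hlit _ (Primrec.sumInl.comp (Primrec.fst.comp Primrec.snd))
        (primrec₂_coord_add.comp (hc.comp (Primrec.fst.comp Primrec.fst))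
          (Primrec.snd.comp Primrec.snd))
  · refine Primrec.list_map (Primrec.const _) (hpair ?_ ?_)
    · exact hlit _ (Primrec.sumInl.comp (Primrec.fst.comp Primrec.snd)) (hc.comp Primrec.fst)
    · exact hlit _ (Primrec.sumInl.comp (Primrec.fst.comp (Primrec.snd.comp Primrec.snd)))
        (primrec₂_coord_add.comp (hc.comp Primrec.fst)
          (Primrec.snd.comp (Primrec.snd.comp Primrec.snd)))
  · refine Primrec.list_map (Primrec.const _) (Primrec.list_cons.comp ?_ ?_)
    · exact hlit _ (Primrec.sumInl.comp Primrec.snd) (hc.comp Primrec.fst)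
    · refine Primrec.list_flatMap (hT.comp Primrec.fst) (Primrec.ite ?_ (hsingle ?_)
        (Primrec.const []))
      · exact Primrec.eq.comp (Primrec.fst.comp Primrec.snd) (Primrec.snd.comp Primrec.fst)
      · exact hlit _ (Primrec.sumInr.comp Primrec.snd) (hc.comp (Primrec.fst.comp Primrec.fst))
  · have happ : Primrec₂ fun (c : Fin 4 → ℕ) (i : Fin 4) => c i := Primrec.fin_app
    refine Primrec.list_flatMap (Primrec.const _) (Primrec.list_flatMap (hT.comp Primrec.fst)
      (Primrec.list_flatMap (hT.comp (Primrec.fst.comp Primrec.fst)) (Primrec.ite ?_ (hsingle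
        (hpair ?_ ?_)) (Primrec.const []))))
    · have he := Primrec.snd.comp (Primrec.fst.comp (Primrec.fst
        (α := ((((List (WangTile n) × Coord n) × Option (PatternCode n)) ×
          ((Fin n × Fin 4) × (Fin n × Fin 4) × Coord n)) × WangTile n)) (β := WangTile n)))
      have hw := Primrec.snd.comp (Primrec.fst
        (α := ((((List (WangTile n) × Coord n) × Option (PatternCode n)) ×
          ((Fin n × Fin 4) × (Fin n × Fin 4) × Coord n)) × WangTile n)) (β := WangTile n))
      have hw' := Primrec.snd
        (α := ((((List (WangTile n) × Coord n) × Option (PatternCode n)) ×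
          ((Fin n × Fin 4) × (Fin n × Fin 4) × Coord n)) × WangTile n)) (β := WangTile n)
      have h1 := Primrec.fst.comp he
      have h2 := Primrec.fst.comp (Primrec.snd.comp he)
      exact (Primrec.eq.comp (Primrec.fst.comp hw) (Primrec.fst.comp h1)).and
        ((Primrec.eq.comp (Primrec.fst.comp hw') (Primrec.fst.comp h2)).and
          (Primrec.eq.comp (happ.comp (Primrec.snd.comp hw) (Primrec.snd.comp h1))
            (happ.comp (Primrec.snd.comp hw') (Primrec.snd.comp h2))).not)
    · exact hlit _ (Primrec.sumInr.comp (Primrec.snd.comp Primrec.fst))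
        (hc.comp (Primrec.fst.comp (Primrec.fst.comp Primrec.fst)))
    · exact hlit _ (Primrec.sumInr.comp Primrec.snd)
        (primrec₂_coord_add.comp (hc.comp (Primrec.fst.comp (Primrec.fst.comp Primrec.fst)))
          (Primrec.snd.comp (Primrec.snd.comp (Primrec.snd.comp (Primrec.fst.comp Primrec.fst)))))
  · refine Primrec.list_flatMap hT (Primrec.list_map (Primrec.const _) (hpair ?_ ?_))
    · exact hlit _ (Primrec.sumInr.comp (Primrec.snd.comp Primrec.fst))
        (hc.comp (Primrec.fst.comp Primrec.fst))
    · exact hlit _ (Primrec.sumInr.comp (Primrec.snd.comp Primrec.fst))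
        (primrec₂_coord_add.comp (hc.comp (Primrec.fst.comp Primrec.fst)) Primrec.snd)
  · refine Primrec.list_map (Primrec.optionToList.comp Primrec.snd)
      (Primrec.list_map Primrec.snd ?_)
    exact hlit _ (Primrec.sumInl.comp (Primrec.fst.comp Primrec.snd))
      (primrec₂_coord_add.comp (hc.comp (Primrec.fst.comp Primrec.fst))
        (Primrec.snd.comp Primrec.snd))

theorem isCoComputablyEnumerable_exists_assignment (F : ℕ → Option (PatternCode n))
    (hF : Computable F) :
    IsCoComputablyEnumerable fun T : List (WangTile n) =>
      ∃ v : Var n → Bool, ∀ i : ℕ × Coord n, ∀ cl ∈ D.clauses T i.2 (F i.1),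
        ∃ l ∈ cl, v l.1 = l.2 := by
  refine RhombusTiling.isCoComputablyEnumerable_exists_assignment
    (fun T (i : ℕ × Coord n) => D.clauses T i.2 (F i.1)) ?_
  have hg : Computable fun q : List (WangTile n) × (ℕ × Coord n) => ((q.1, q.2.2), F q.2.1) :=
    (Computable.fst.pair (Computable.snd.comp Computable.snd)).pair
      (hF.comp (Computable.fst.comp Computable.snd))
  exact Computable.comp (g := fun q : List (WangTile n) × (ℕ × Coord n) =>
    ((q.1, q.2.2), F q.2.1)) D.primrec_clauses.to_comp hg

end ClauseData

/-! ### Chains of bounded length -/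

section Linked

variable {β : Type*}

/-- `Linked r k a b`: there is a chain of `k` steps of `r` from `a` to `b`. -/
def Linked (r : β → β → Prop) : ℕ → β → β → Prop
  | 0, a, b => a = b
  | k + 1, a, b => ∃ c, r a c ∧ Linked r k c b

variable {r : β → β → Prop}

theorem Linked.trans {j k : ℕ} {a b c : β} (h : Linked r j a b) (h' : Linked r k b c) :
    Linked r (j + k) a c := by
  induction j generalizing a with
  | zero => obtain rfl : a = b := h; simpa using h'
  | succ j ih =>
    obtain ⟨d, had, hdb⟩ := h
    rw [Nat.add_right_comm]
    exact ⟨d, had, ih hdb⟩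

theorem Linked.one {a b : β} (h : r a b) : Linked r 1 a b := ⟨b, h, rfl⟩

theorem Linked.symm [Std.Symm r] {k : ℕ} {a b : β} (h : Linked r k a b) : Linked r k b a := by
  induction k generalizing a with
  | zero => exact Eq.symm h
  | succ k ih =>
    obtain ⟨d, had, hdb⟩ := h
    exact (ih hdb).trans (Linked.one (_root_.symm had))

theorem Linked.mono [Std.Refl r] {j k : ℕ} {a b : β} (h : Linked r j a b) (hjk : j ≤ k) :
    Linked r k a b := by
  induction hjk with
  | refl => exact h
  | step _ ih => exact ⟨a, refl a, ih⟩

theorem exists_int_chain (P : ℤ → β → Prop) (hs : ∀ i b, P i b → ∃ b', P (i + 1) b' ∧ r b b')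
    (hp : ∀ i b, P i b → ∃ b', P (i - 1) b' ∧ r b' b) {b₀ : β} (h₀ : P 0 b₀) :
    ∃ f : ℤ → β, f 0 = b₀ ∧ ∀ i, P i (f i) ∧ r (f i) (f (i + 1)) := by
  have : Nonempty β := ⟨b₀⟩
  choose! s hs hsr using hs
  choose! p hp hpr using hp
  let u : ℕ → β := fun m => Nat.rec b₀ (fun k b => s k b) m
  let v : ℕ → β := fun m => Nat.rec b₀ (fun k b => p (-k) b) m
  have hu : ∀ m : ℕ, P m (u m) := fun m => by
    induction m with
    | zero => exact h₀
    | succ m ih => exact_mod_cast hs m _ ih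
  have hv : ∀ m : ℕ, P (-m) (v m) := fun m => by
    induction m with
    | zero => simpa [v] using h₀
    | succ m ih =>
      have := hp _ _ ih
      rwa [show -(m : ℤ) - 1 = -((m + 1 : ℕ) : ℤ) by push_cast; ring] at this
  refine ⟨fun i => if 0 ≤ i then u i.toNat else v (-i).toNat, by simp [u], fun i => ⟨?_, ?_⟩⟩
  · dsimp only
    split_ifs with h
    · have := hu i.toNat
      rwa [Int.toNat_of_nonneg h] at this
    · have := hv (-i).toNat
      rwa [Int.toNat_of_nonneg (by omega), neg_neg] at this
  · dsimp only
    by_cases h : 0 ≤ i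
    · rw [if_pos h, if_pos (by omega), show (i + 1).toNat = i.toNat + 1 by omega]
      have := hsr _ _ (hu i.toNat)
      exact this
    · obtain ⟨m, rfl⟩ : ∃ m : ℕ, i = -((m : ℤ) + 1) := ⟨(-i).toNat - 1, by omega⟩
      rw [if_neg h, show (-(-((m : ℤ) + 1))).toNat = m + 1 by omega]
      have hr := hpr _ _ (hv m)
      by_cases h' : 0 ≤ -((m : ℤ) + 1) + 1
      · obtain rfl : m = 0 := by omega
        simpa [u, v] using hr
      · rw [if_neg h', show (-(-((m : ℤ) + 1) + 1)).toNat = m by omega]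
        exact hr

end Linked

/-! ### Selecting one sheet over the plane -/

section Monodromy

theorem dist_le_add_abs (x y : Plane) : dist x y ≤ |x 0 - y 0| + |x 1 - y 1| := by
  rw [EuclideanSpace.dist_eq, Fin.sum_univ_two, Real.dist_eq, Real.dist_eq]
  refine Real.sqrt_le_iff.2 ⟨by positivity, ?_⟩
  nlinarith [abs_nonneg (x 0 - y 0), abs_nonneg (x 1 - y 1)]

theorem abs_sub_le_dist (x y : Plane) (k : Fin 2) : |x k - y k| ≤ dist x y := by
  rw [dist_eq_norm]
  simpa using PiLp.norm_apply_le (x - y) k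

/-- The point with indices `i`, `j` of the square grid of mesh `δ` through `p`. -/
noncomputable def gridPoint (p : Plane) (δ : ℝ) (i j : ℤ) : Plane :=
  !₂[p 0 + δ * i, p 1 + δ * j]

theorem exists_dist_gridPoint_le (p q : Plane) {δ : ℝ} (hδ : 0 < δ) :
    dist (gridPoint p δ (round ((q 0 - p 0) / δ)) (round ((q 1 - p 1) / δ))) q ≤ δ := by
  have key : ∀ x : ℝ, |δ * round (x / δ) - x| ≤ δ / 2 := fun x => by
    have h := abs_sub_round (x / δ)
    rw [abs_sub_comm] at h
    have h2 : δ * round (x / δ) - x = δ * (round (x / δ) - x / δ) := by field_simp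
    rw [h2, abs_mul, abs_of_pos hδ]
    nlinarith
  refine (dist_le_add_abs _ _).trans ?_
  have h0 := key (q 0 - p 0)
  have h1 := key (q 1 - p 1)
  have e0 : p 0 + δ * round ((q 0 - p 0) / δ) - q 0 =
    δ * round ((q 0 - p 0) / δ) - (q 0 - p 0) := by ring
  have e1 : p 1 + δ * round ((q 1 - p 1) / δ) - q 1 =
    δ * round ((q 1 - p 1) / δ) - (q 1 - p 1) := by ring
  simp only [gridPoint, PiLp.toLp_apply, Matrix.cons_val_zero, Matrix.cons_val_one, e0, e1]
  linarith

theorem abs_round_sub_round_le {x y : ℝ} (h : |x - y| < 1) : |round x - round y| ≤ 1 := by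
  rw [abs_lt] at h
  have hx := abs_le.1 (abs_sub_round x)
  have hy := abs_le.1 (abs_sub_round y)
  have h1 : ((round x - round y : ℤ) : ℝ) < 2 := by push_cast; linarith
  have h2 : (-2 : ℝ) < ((round x - round y : ℤ) : ℝ) := by push_cast; linarith
  have h1' : round x - round y < 2 := by exact_mod_cast h1
  have h2' : -2 < round x - round y := by exact_mod_cast h2
  rw [abs_le]
  omega

variable {β : Type*} {r : β → β → Prop} [Std.Refl r] [Std.Symm r] {supp : β → Set Plane} {ε : ℝ}

/-- Tiles are continued along one column, then along each row from that column, so horizontal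
neighbours are related by construction. Vertical closeness propagates along the rows, because two
tiles above the same point joined by a short chain are neighbours. This is discrete path lifting. -/
theorem exists_grid_selection (hε : 0 < ε)
    (hcov : ∀ t p q, p ∈ supp t → dist p q < ε → ∃ t', r t t' ∧ q ∈ supp t')
    (hinj : ∀ t t' p, Linked r 6 t t' → p ∈ supp t → p ∈ supp t' → r t t')
    {t₀ : β} {p₀ : Plane} (h₀ : p₀ ∈ supp t₀) :
    ∃ T : ℤ → ℤ → β, (∀ i j, gridPoint p₀ (ε / 2) i j ∈ supp (T i j)) ∧
      (∀ i j, r (T i j) (T (i + 1) j)) ∧ ∀ i j, Linked r 2 (T i j) (T i (j + 1)) := by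
  have hd1 : ∀ i j, dist (gridPoint p₀ (ε / 2) i j) (gridPoint p₀ (ε / 2) (i + 1) j) < ε := by
    intro i j
    refine (dist_le_add_abs _ _).trans_lt ?_
    have e : p₀ 0 + ε / 2 * i - (p₀ 0 + ε / 2 * (i + 1)) = -(ε / 2) := by ring
    simpa [gridPoint, e, abs_of_pos (half_pos hε)] using half_lt_self hε
  have hd2 : ∀ i j, dist (gridPoint p₀ (ε / 2) i j) (gridPoint p₀ (ε / 2) i (j + 1)) < ε := by
    intro i j
    refine (dist_le_add_abs _ _).trans_lt ?_
    have e : p₀ 1 + ε / 2 * j - (p₀ 1 + ε / 2 * (j + 1)) = -(ε / 2) := by ring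
    simpa [gridPoint, e, abs_of_pos (half_pos hε)] using half_lt_self hε
  have hd1' : ∀ i j, dist (gridPoint p₀ (ε / 2) i j) (gridPoint p₀ (ε / 2) (i - 1) j) < ε := by
    intro i j
    have := hd1 (i - 1) j
    rwa [sub_add_cancel, dist_comm] at this
  have hd2' : ∀ i j, dist (gridPoint p₀ (ε / 2) i j) (gridPoint p₀ (ε / 2) i (j - 1)) < ε := by
    intro i j
    have := hd2 i (j - 1)
    rwa [sub_add_cancel, dist_comm] at this
  obtain ⟨c, hc0, hc⟩ := exists_int_chain (r := r)
    (fun j t => gridPoint p₀ (ε / 2) 0 j ∈ supp t)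
    (fun j t ht => (hcov t _ _ ht (hd2 0 j)).imp fun _ h => ⟨h.2, h.1⟩)
    (fun j t ht => (hcov t _ _ ht (hd2' 0 j)).imp fun _ h => ⟨h.2, symm h.1⟩)
    (b₀ := t₀) (by
      have : gridPoint p₀ (ε / 2) 0 0 = p₀ := by
        ext k
        fin_cases k <;> simp [gridPoint]
      rwa [this])
  have hrow : ∀ j, ∃ f : ℤ → β, f 0 = c j ∧
      ∀ i, gridPoint p₀ (ε / 2) i j ∈ supp (f i) ∧ r (f i) (f (i + 1)) := fun j =>
    exists_int_chain (r := r) (fun i t => gridPoint p₀ (ε / 2) i j ∈ supp t)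
      (fun i t ht => (hcov t _ _ ht (hd1 i j)).imp fun _ h => ⟨h.2, h.1⟩)
      (fun i t ht => (hcov t _ _ ht (hd1' i j)).imp fun _ h => ⟨h.2, symm h.1⟩) (hc j).1
  choose T hT0 hT using hrow
  refine ⟨fun i j => T j i, fun i j => (hT j i).1, fun i j => (hT j i).2, fun i j => ?_⟩
  -- Going round a grid square gives a chain of length 1 + 1 + 2 + 1 = 5 between two tiles over the
  -- same corner. `hinj` shortens it to one step, so the vertical bound 2 does not grow along the
  -- row.
  have hstep : ∀ i i' : ℤ, r (T j i) (T j i') → r (T (j + 1) i) (T (j + 1) i') →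
      Linked r 2 (T j i) (T (j + 1) i) → Linked r 2 (T j i') (T (j + 1) i') := by
    intro i i' h1 h2 h3
    obtain ⟨t, ht, hpt⟩ := hcov _ _ _ (hT j i').1 (hd2 i' j)
    refine ⟨t, ht, _, hinj _ _ _ ?_ hpt (hT (j + 1) i').1, rfl⟩
    exact ((((Linked.one (symm ht)).trans (Linked.one (symm h1))).trans h3).trans
      (Linked.one h2)).mono (by norm_num)
  induction i using Int.induction_on with
  | zero =>
    simp only [hT0]
    exact (Linked.one (hc j).2).mono (by norm_num)
  | succ m ih => exact hstep _ _ (hT j m).2 (hT (j + 1) m).2 ih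
  | pred m ih =>
    have h1 := (hT j (-m - 1)).2
    have h2 := (hT (j + 1) (-m - 1)).2
    rw [sub_add_cancel] at h1 h2
    exact hstep _ _ (symm h1) (symm h2) ih

/-- Each point receives the tile of a nearest grid point. Points closer than the mesh round to
indices differing by at most one, whence 1 + 2 = 3 steps. -/
theorem exists_plane_selection (hε : 0 < ε)
    (hcov : ∀ t p q, p ∈ supp t → dist p q < ε → ∃ t', r t t' ∧ q ∈ supp t')
    (hinj : ∀ t t' p, Linked r 6 t t' → p ∈ supp t → p ∈ supp t' → r t t')
    {t₀ : β} (h₀ : (supp t₀).Nonempty) :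
    ∃ τ : Plane → β, (∀ p, ∃ t, r (τ p) t ∧ p ∈ supp t) ∧
      ∀ p q, dist p q < ε / 2 → Linked r 3 (τ p) (τ q) := by
  obtain ⟨p₀, h₀⟩ := h₀
  obtain ⟨T, hT, hT1, hT2⟩ := exists_grid_selection hε hcov hinj h₀
  have hδ : 0 < ε / 2 := by positivity
  refine ⟨fun p => T (round ((p 0 - p₀ 0) / (ε / 2))) (round ((p 1 - p₀ 1) / (ε / 2))),
    fun p => hcov _ _ _ (hT _ _) ((exists_dist_gridPoint_le p₀ p hδ).trans_lt (by linarith)),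
    fun p q hpq => ?_⟩
  have hround : ∀ k, |round ((p k - p₀ k) / (ε / 2)) - round ((q k - p₀ k) / (ε / 2))| ≤ 1 := by
    intro k
    apply abs_round_sub_round_le
    rw [← sub_div, abs_div, abs_of_pos hδ, div_lt_one hδ, sub_sub_sub_cancel_right]
    exact (abs_sub_le_dist p q k).trans_lt hpq
  have hcase : ∀ a b : ℤ, |a - b| ≤ 1 → b = a ∨ b = a + 1 ∨ a = b + 1 := fun a b h => by
    rw [abs_le] at h
    omega
  have h1 : ∀ a b j : ℤ, |a - b| ≤ 1 → Linked r 1 (T a j) (T b j) := fun a b j h => by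
    rcases hcase a b h with rfl | rfl | rfl
    · exact Linked.one (refl _)
    · exact Linked.one (hT1 _ _)
    · exact Linked.one (symm (hT1 _ _))
  have h2 : ∀ i a b : ℤ, |a - b| ≤ 1 → Linked r 2 (T i a) (T i b) := fun i a b h => by
    rcases hcase a b h with rfl | rfl | rfl
    · exact (Linked.one (refl _)).mono (by norm_num)
    · exact hT2 _ _
    · exact (hT2 _ _).symm
  exact (h1 _ _ _ (hround 0)).trans (h2 _ _ _ (hround 1))

/-- If every tile is surrounded by its neighbours, uniformly, and nearby tiles with a common point
are neighbours, then some set of tiles covers the plane in such a way that any two of its members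
with a common point are neighbours. -/
theorem exists_sheet (hε : 0 < ε) (hconn : ∀ t, IsPreconnected (supp t))
    (hcov : ∀ t p q, p ∈ supp t → dist p q < ε → ∃ t', r t t' ∧ q ∈ supp t')
    (hinj : ∀ t t' p, Linked r 6 t t' → p ∈ supp t → p ∈ supp t' → r t t')
    {t₀ : β} (h₀ : (supp t₀).Nonempty) :
    ∃ Y : Set β, (∀ p, ∃ t ∈ Y, p ∈ supp t) ∧
      ∀ t ∈ Y, ∀ t' ∈ Y, ∀ p, p ∈ supp t → p ∈ supp t' → r t t' := by
  obtain ⟨τ, hτ1, hτ2⟩ := exists_plane_selection hε hcov hinj h₀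
  -- Being two steps from the selection persists from `p` to a close `q`: the chain of length 2 + 3
  -- + 1 = 6 joins `t` to a tile over `q`, and `hinj` collapses it. This fixes the constant 6;
  -- connectedness of the tile does the rest.
  have hmove : ∀ t p q, p ∈ supp t → q ∈ supp t → Linked r 2 t (τ p) → Linked r 2 t (τ q) := by
    intro t p q hp hq
    have hnear : ∀ p q, p ∈ supp t → q ∈ supp t → dist p q < ε / 2 →
        Linked r 2 t (τ p) → Linked r 2 t (τ q) := by
      intro p q _ hq hpq h
      obtain ⟨t', ht', hq'⟩ := hτ1 q
      exact ⟨t', hinj t t' q ((h.trans (hτ2 p q hpq)).trans (Linked.one ht')) hq hq',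
        _, _root_.symm ht', rfl⟩
    refine (hconn t).induction₂' (fun p q => Linked r 2 t (τ p) → Linked r 2 t (τ q))
      (fun p hp => ?_) (fun _ _ _ _ _ _ h h' => h' ∘ h) hp hq
    filter_upwards [self_mem_nhdsWithin,
      mem_nhdsWithin_of_mem_nhds (Metric.ball_mem_nhds p (half_pos hε))] with q hq hpq
    exact ⟨hnear p q hp hq (by rwa [dist_comm]), hnear q p hq hp hpq⟩
  refine ⟨{t | ∃ p ∈ supp t, Linked r 2 t (τ p)}, fun p => ?_, ?_⟩
  · obtain ⟨t, ht, hp⟩ := hτ1 p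
    exact ⟨t, ⟨p, hp, (Linked.one (symm ht)).mono (by norm_num)⟩, hp⟩
  -- Both tiles are within two steps of the selected tile at their common point, hence within four
  -- of each other.
  · rintro t ⟨q, hq, hqt⟩ t' ⟨q', hq', hqt'⟩ p hp hp'
    exact hinj t t' p (((hmove t q p hq hp hqt).trans (hmove t' q' p hq' hp' hqt').symm).mono
      (by norm_num)) hp hp'

end Monodromy

theorem exists_pos_forall_le {ι : Type*} [Finite ι] {f : ι → ℝ} (hf : ∀ i, 0 < f i) :
    ∃ ε > 0, ∀ i, ε ≤ f i := by
  cases isEmpty_or_nonempty ι with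
  | inl h => exact ⟨1, one_pos, fun i => h.elim i⟩
  | inr h =>
    obtain ⟨i, hi⟩ := Finite.exists_min f
    exact ⟨f i, hf i, hi⟩

/-! ### Geometry of rhombuses and local finiteness of tilings -/

section Geometry

variable {n : ℕ} (S : ShapeSet n)

theorem support_eq_image (t : PlacedShape n) : support S t =
    (fun q : ℝ × ℝ => t.2 + q.1 • (S t.1).u + q.2 • (S t.1).v) '' (Icc 0 1 ×ˢ Icc 0 1) := by
  ext x
  constructor
  · rintro ⟨a, ha, b, hb, rfl⟩
    exact ⟨(a, b), ⟨ha, hb⟩, rfl⟩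
  · rintro ⟨⟨a, b⟩, ⟨ha, hb⟩, rfl⟩
    exact ⟨a, ha, b, hb, rfl⟩

theorem isCompact_support (t : PlacedShape n) : IsCompact (support S t) := by
  rw [support_eq_image]
  exact (isCompact_Icc.prod isCompact_Icc).image (by fun_prop)

theorem isPreconnected_support (t : PlacedShape n) : IsPreconnected (support S t) := by
  rw [support_eq_image]
  exact (isPreconnected_Icc.prod isPreconnected_Icc).image _ (by fun_prop)

theorem position_mem_support (t : PlacedShape n) : t.2 ∈ support S t :=
  ⟨0, by simp, 0, by simp, by simp⟩

theorem support_add (t : PlacedShape n) (d : Plane) :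
    support S (t.1, t.2 + d) = (· + d) '' support S t := by
  rw [support_eq_image, support_eq_image, image_image]
  refine image_congr fun q _ => ?_
  dsimp only
  abel

theorem vertex_add (t : PlacedShape n) (d : Plane) (k : Fin 4) :
    vertex S (t.1, t.2 + d) k = vertex S t k + d := by
  fin_cases k <;> simp [vertex] <;> abel

theorem edge_add (t : PlacedShape n) (d : Plane) (k : Fin 4) :
    edge S (t.1, t.2 + d) k = (· + d) '' edge S t k := by
  rw [edge, edge, vertex_add, vertex_add, ← image_congr fun x _ => add_comm d x,
    segment_translate_image, add_comm d, add_comm d]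

theorem meetEdgeToEdge_add_iff (t t' : PlacedShape n) (d : Plane) :
    MeetEdgeToEdge S (t.1, t.2 + d) (t'.1, t'.2 + d) ↔ MeetEdgeToEdge S t t' := by
  have hinj : Function.Injective fun x : Plane => x + d := add_left_injective d
  simp only [MeetEdgeToEdge, support_add, vertex_add, edge_add, ← image_inter hinj,
    image_eq_empty, add_left_inj, hinj.image_injective.eq_iff]
  have : ∀ k, ({vertex S t k + d} : Set Plane) = (· + d) '' {vertex S t k} := fun k => by simp
  simp only [this, hinj.image_injective.eq_iff]

/-- With `c` as origin and `d - c` as unit, the parameter 0 of `c` is a convex combination of the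
nonnegative parameters of `a` and `b`. Either `a` has parameter 0, or `b` does and then `a` must be
`d`. -/
theorem eq_or_eq_of_segment_eq {E : Type*} [AddCommGroup E] [Module ℝ E] {a b c d : E}
    (h : segment ℝ a b = segment ℝ c d) : a = c ∨ a = d := by
  have ha : a ∈ segment ℝ c d := h ▸ left_mem_segment ℝ a b
  have hb : b ∈ segment ℝ c d := h ▸ right_mem_segment ℝ a b
  have hc : c ∈ segment ℝ a b := h ▸ left_mem_segment ℝ c d
  have hd : d ∈ segment ℝ a b := h ▸ right_mem_segment ℝ c d
  rw [segment_eq_image'] at ha hb hc hd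
  obtain ⟨s, ⟨hs0, hs1⟩, rfl⟩ := ha
  obtain ⟨t, ⟨ht0, ht1⟩, rfl⟩ := hb
  obtain ⟨q, ⟨hq0, hq1⟩, hc⟩ := hc
  obtain ⟨q', ⟨hq0', hq1'⟩, hd⟩ := hd
  rw [← sub_eq_zero] at hc hd
  have hc' : ((1 - q) * s + q * t) • (d - c) = 0 := by rw [← hc]; module
  have hd' : ((1 - q') * s + q' * t - 1) • (d - c) = 0 := by rw [← hd]; module
  rcases eq_or_ne (d - c) 0 with hw | hw
  · simp [hw]
  rw [smul_eq_zero_iff_left hw] at hc' hd'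
  have h1 : 0 ≤ (1 - q) * s := mul_nonneg (by linarith) hs0
  have h2 : 0 ≤ q * t := mul_nonneg hq0 ht0
  have h3 : (1 - q) * s = 0 := by linarith
  rcases mul_eq_zero.1 h3 with h4 | h4
  · obtain rfl : q = 1 := by linarith
    obtain rfl : t = 0 := by linarith
    obtain rfl : s = 1 := by nlinarith
    right
    simp
  · left
    simp [h4]

/-- Two placed shapes with a common vertex. -/
def ShareVertex (t t' : PlacedShape n) : Prop := ∃ k l, vertex S t k = vertex S t' l

variable {S}

theorem shareVertex_of_edge_eq {t t' : PlacedShape n} {k l : Fin 4}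
    (h : edge S t k = edge S t' l) : ShareVertex S t t' := by
  rcases eq_or_eq_of_segment_eq h with h | h
  · exact ⟨_, _, h⟩
  · exact ⟨_, _, h⟩

theorem MeetEdgeToEdge.shareVertex {t t' : PlacedShape n} (h : MeetEdgeToEdge S t t')
    {p : Plane} (hp : p ∈ support S t) (hp' : p ∈ support S t') : ShareVertex S t t' := by
  rcases h with h | ⟨k, l, h, -⟩ | ⟨k, l, h, -⟩
  · exact absurd h (Set.Nonempty.ne_empty ⟨p, hp, hp'⟩)
  · exact ⟨k, l, h⟩
  · exact shareVertex_of_edge_eq h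

variable (S)

theorem shareVertex_refl (t : PlacedShape n) : ShareVertex S t t := ⟨0, 0, rfl⟩

variable {S} in
theorem ShareVertex.symm {t t' : PlacedShape n} (h : ShareVertex S t t') : ShareVertex S t' t :=
  let ⟨k, l, h⟩ := h
  ⟨l, k, Eq.symm h⟩

/-- The centre of a placed shape. -/
noncomputable def centre (t : PlacedShape n) : Plane :=
  t.2 + (1 / 2 : ℝ) • (S t.1).u + (1 / 2 : ℝ) • (S t.1).v

theorem centre_mem_support (t : PlacedShape n) : centre S t ∈ support S t :=
  ⟨1 / 2, by norm_num, 1 / 2, by norm_num, rfl⟩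

theorem centre_notMem_edge (t : PlacedShape n) (k : Fin 4) : centre S t ∉ edge S t k := by
  intro h
  have hind := LinearIndependent.pair_iff.1 (S t.1).indep
  rw [edge, segment_eq_image'] at h
  obtain ⟨θ, -, h⟩ := h
  rw [← sub_eq_zero] at h
  fin_cases k
  · have := (hind (θ - 1 / 2) (-1 / 2) (by rw [← h]; simp [vertex, centre]; module)).2
    norm_num at this
  · have := (hind (1 / 2) (θ - 1 / 2) (by rw [← h]; simp [vertex, centre]; module)).1
    norm_num at this
  · have := (hind (1 / 2 - θ) (1 / 2) (by rw [← h]; simp [vertex, centre]; module)).2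
    norm_num at this
  · have := (hind (-1 / 2) (1 / 2 - θ) (by rw [← h]; simp [vertex, centre]; module)).1
    norm_num at this

theorem exists_ball_centre_subset_support :
    ∃ ρ > 0, ∀ t : PlacedShape n, Metric.ball (centre S t) ρ ⊆ support S t := by
  have hs : ∀ s : Fin n, ∃ ρ > 0, Metric.ball (centre S (s, 0)) ρ ⊆ support S (s, 0) := by
    intro s
    have hcard : Fintype.card (Fin 2) = Module.finrank ℝ Plane := by simp
    let b := basisOfLinearIndependentOfCardEqFinrank (S s).indep hcard
    have hb : ∀ x : Plane, x = b.repr x 0 • (S s).u + b.repr x 1 • (S s).v := fun x => by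
      conv_lhs => rw [← b.sum_repr x]
      simp [Fin.sum_univ_two, b]
    have hcont : ∀ k, Continuous fun x : Plane => b.repr x k := fun k =>
      (b.coord k).continuous_of_finiteDimensional
    let U : Set Plane := {x | b.repr x 0 ∈ Ioo (0 : ℝ) 1} ∩ {x | b.repr x 1 ∈ Ioo (0 : ℝ) 1}
    have hU : IsOpen U := (isOpen_Ioo.preimage (hcont 0)).inter (isOpen_Ioo.preimage (hcont 1))
    have hbu : b.repr (S s).u = Finsupp.single 0 1 := by
      have := b.repr_self 0
      simpa [b] using this
    have hbv : b.repr (S s).v = Finsupp.single 1 1 := by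
      have := b.repr_self 1
      simpa [b] using this
    have hc : centre S (s, 0) ∈ U := by
      simp [U, centre, hbu, hbv]
      norm_num
    obtain ⟨ρ, hρ, hsub⟩ := Metric.isOpen_iff.1 hU _ hc
    refine ⟨ρ, hρ, fun x hx => ?_⟩
    have hxU := hsub hx
    refine ⟨b.repr x 0, Ioo_subset_Icc_self hxU.1, b.repr x 1, Ioo_subset_Icc_self hxU.2, ?_⟩
    simpa using hb x
  choose ρ hρ hsub using hs
  obtain ⟨ρ₀, hρ₀, hle⟩ := exists_pos_forall_le hρ
  refine ⟨ρ₀, hρ₀, fun t x hx => ?_⟩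
  have h1 : support S t = (· + t.2) '' support S (t.1, 0) := by
    rw [← support_add]
    simp
  rw [h1]
  refine ⟨x - t.2, hsub t.1 (Metric.ball_subset_ball (hle t.1) ?_), by simp⟩
  rw [Metric.mem_ball, dist_eq_norm] at hx ⊢
  convert hx using 2
  simp [centre]
  abel

theorem exists_support_subset_closedBall :
    ∃ R, ∀ t : PlacedShape n, support S t ⊆ Metric.closedBall (centre S t) R := by
  refine ⟨∑ s, (‖(S s).u‖ + ‖(S s).v‖), ?_⟩
  rintro t x ⟨a, ha, b, hb, rfl⟩
  rw [Metric.mem_closedBall, dist_eq_norm]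
  have h1 : t.2 + a • (S t.1).u + b • (S t.1).v - centre S t =
      (a - 1 / 2) • (S t.1).u + (b - 1 / 2) • (S t.1).v := by
    rw [centre]
    module
  have ha' : |a - 1 / 2| ≤ 1 := abs_le.2 ⟨by linarith [ha.1], by linarith [ha.2]⟩
  have hb' : |b - 1 / 2| ≤ 1 := abs_le.2 ⟨by linarith [hb.1], by linarith [hb.2]⟩
  calc _ ≤ ‖(a - 1 / 2) • (S t.1).u‖ + ‖(b - 1 / 2) • (S t.1).v‖ := h1 ▸ norm_add_le _ _
    _ ≤ ‖(S t.1).u‖ + ‖(S t.1).v‖ := by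
      rw [norm_smul, norm_smul]
      exact add_le_add (mul_le_of_le_one_left (norm_nonneg _) ha')
        (mul_le_of_le_one_left (norm_nonneg _) hb')
    _ ≤ _ := Finset.single_le_sum (f := fun s => ‖(S s).u‖ + ‖(S s).v‖)
      (fun _ _ => by positivity) (Finset.mem_univ t.1)

variable {S}

/-- An edge-to-edge intersection lies in a side, and the centre lies on no side. This separates the
centres of distinct tiles. -/
theorem MeetEdgeToEdge.centre_notMem {t t' : PlacedShape n} (h : MeetEdgeToEdge S t t') :
    centre S t ∉ support S t' := by
  intro hc
  have hmem : centre S t ∈ support S t ∩ support S t' := ⟨centre_mem_support S t, hc⟩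
  rcases h with h | ⟨k, l, -, h⟩ | ⟨k, l, -, h⟩
  · rw [h] at hmem
    exact hmem
  · rw [h] at hmem
    have : centre S t ∈ edge S t k := by
      rw [mem_singleton_iff.1 hmem]
      exact left_mem_segment ℝ _ _
    exact centre_notMem_edge S t k this
  · rw [h] at hmem
    exact centre_notMem_edge S t k hmem

/-- Each tile contains a ball of uniform radius about its centre and no other centre, so centres are
uniformly separated. The tiles meeting a unit ball have centres in a bounded region and inject into
a finite net. -/
theorem locallyFinite_support {x : Set (PlacedShape n)} (hx : x.Pairwise (MeetEdgeToEdge S)) :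
    LocallyFinite fun t : x => support S (t : PlacedShape n) := by
  obtain ⟨ρ, hρ, hball⟩ := exists_ball_centre_subset_support S
  obtain ⟨R, hR⟩ := exists_support_subset_closedBall S
  intro q
  refine ⟨Metric.ball q 1, Metric.ball_mem_nhds q one_pos, ?_⟩
  have htb : TotallyBounded (Metric.closedBall q (R + 1)) :=
    (isCompact_closedBall q (R + 1)).totallyBounded
  obtain ⟨N, hN, hcover⟩ := Metric.totallyBounded_iff.1 htb (ρ / 2) (half_pos hρ)
  have hcentre : ∀ t ∈ {t : x | (support S (t : PlacedShape n) ∩ Metric.ball q 1).Nonempty},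
      ∃ y ∈ N, dist (centre S (t : PlacedShape n)) y < ρ / 2 := by
    rintro t ⟨z, hz, hzq⟩
    have h1 := Metric.mem_closedBall.1 (hR t hz)
    have h2 := Metric.mem_ball.1 hzq
    have : centre S (t : PlacedShape n) ∈ Metric.closedBall q (R + 1) := by
      rw [Metric.mem_closedBall]
      have := dist_triangle_left (centre S (t : PlacedShape n)) q z
      linarith
    simpa using hcover this
  choose! y hyN hy using hcentre
  refine Set.Finite.of_injOn (f := y) (t := N) hyN (fun t ht t' ht' htt' => ?_) hN
  by_contra hne
  have hne' : (t' : PlacedShape n) ≠ t := fun h => hne (Subtype.ext h.symm)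
  refine (hx t'.2 t.2 hne').centre_notMem (hball _ ?_)
  have h1 := hy t ht
  have h2 := hy t' ht'
  rw [← htt'] at h2
  rw [Metric.mem_ball]
  have := dist_triangle_right (centre S (t' : PlacedShape n)) (centre S (t : PlacedShape n)) (y t)
  linarith

/-- The tiles sharing no vertex with `t` miss it, and by local finiteness their union is closed. Its
complement is an open neighbourhood of `t` covered by the vertex neighbours. -/
theorem IsTiling.support_subset_interior {x : Set (PlacedShape n)} (hx : IsTiling S x)
    {t : PlacedShape n} (ht : t ∈ x) :
    support S t ⊆ interior (⋃ t' ∈ {t' ∈ x | ShareVertex S t t'}, support S t') := by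
  have hclosed : IsClosed (⋃ t' : {t' : x // ¬ ShareVertex S t t'},
      support S (t' : PlacedShape n)) :=
    ((locallyFinite_support hx.2).comp_injective Subtype.val_injective).isClosed_iUnion
      fun t' => (isCompact_support S _).isClosed
  refine Subset.trans ?_ (interior_maximal ?_ hclosed.isOpen_compl)
  · intro p hp hp'
    obtain ⟨⟨⟨t', ht'⟩, hns⟩, hpt'⟩ := mem_iUnion.1 hp'
    have hne : t ≠ t' := fun h => hns (h ▸ shareVertex_refl S t)
    exact hns ((hx.2 ht ht' hne).shareVertex hp hpt')
  · intro p hp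
    have hpu : p ∈ setSupport S x := hx.1 ▸ mem_univ p
    obtain ⟨t', ht', hpt'⟩ := mem_iUnion₂.1 hpu
    refine mem_iUnion₂.2 ⟨t', ⟨ht', ?_⟩, hpt'⟩
    by_contra hns
    exact hp (mem_iUnion.2 ⟨⟨⟨t', ht'⟩, hns⟩, hpt'⟩)

end Geometry

open scoped Pointwise

/-! ### Meaning of the clauses -/

namespace ClauseData

variable {n : ℕ} (D : ClauseData n)

/-- The assignment `v` satisfies the clauses built from the tiles `T` and the patterns `F`. -/
structure Satisfies (T : List (WangTile n)) (F : ℕ → Option (PatternCode n))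
    (v : Var n → Prop) : Prop where
  origin : ∃ s, v (Sum.inl s, 0)
  forced : ∀ h ∈ D.forced, ∀ c, v (Sum.inl h.1, c) → ∃ e ∈ h.2, v (Sum.inl e.1, c + e.2)
  excluded : ∀ b ∈ D.excluded, ∀ c, v (Sum.inl b.1, c) → ¬ v (Sum.inl b.2.1, c + b.2.2)
  coloured : ∀ s c, v (Sum.inl s, c) → ∃ w ∈ T, w.1 = s ∧ v (Sum.inr w, c)
  glued : ∀ e ∈ D.glued, ∀ w ∈ T, ∀ w' ∈ T, ∀ c, w.1 = e.1.1 → w'.1 = e.2.1.1 →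
    v (Sum.inr w, c) → v (Sum.inr w', c + e.2.2) → w.2 e.1.2 = w'.2 e.2.1.2
  periodic : ∀ w ∈ T, ∀ κ ∈ D.periods, ∀ c, v (Sum.inr w, c) → v (Sum.inr w, c + κ)
  avoids : ∀ k, ∀ P ∈ F k, ∀ c, ∃ e ∈ P, ¬ v (Sum.inl e.1, c + e.2)

theorem forall_clauses_iff (T : List (WangTile n)) (F : ℕ → Option (PatternCode n))
    (v : Var n → Bool) :
    (∀ i : ℕ × Coord n, ∀ cl ∈ D.clauses T i.2 (F i.1), ∃ l ∈ cl, v l.1 = l.2) ↔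
      D.Satisfies T F fun a => v a = true := by
  constructor
  · intro h
    simp only [clauses, List.mem_append, or_imp, forall_and] at h
    obtain ⟨⟨⟨⟨⟨⟨h0, h1⟩, h2⟩, h3⟩, h4⟩, h5⟩, h6⟩ := h
    refine ⟨?_, ?_, ?_, ?_, ?_, ?_, ?_⟩
    · simpa using h0
    · intro a ha c hv
      have := h1 (0, c) _ (List.mem_map_of_mem ha)
      simpa [hv] using this
    · intro a ha c hv
      have := h2 (0, c) _ (List.mem_map_of_mem ha)
      simpa [hv] using this
    · intro s c hv
      have := h3 (0, c) _ (List.mem_map_of_mem (List.mem_finRange s))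
      simp only [List.exists_mem_cons_iff, hv, Bool.true_eq_false, false_or,
        List.mem_flatMap] at this
      obtain ⟨l, ⟨w, hw, hl⟩, hvl⟩ := this
      split_ifs at hl with hws
      · obtain rfl := List.mem_singleton.1 hl
        exact ⟨w, hw, hws, hvl⟩
      · simp at hl
    · intro e he w hw w' hw' c hwe hwe' hv hv'
      by_contra hne
      have := h4 (0, c) [((Sum.inr w, c), false), ((Sum.inr w', c + e.2.2), false)]
        (List.mem_flatMap.2 ⟨e, he, List.mem_flatMap.2 ⟨w, hw, List.mem_flatMap.2 ⟨w', hw', by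
          rw [if_pos ⟨hwe, hwe', hne⟩]
          exact List.mem_singleton_self _⟩⟩⟩)
      simp [hv, hv'] at this
    · intro w hw κ hκ c hv
      have := h5 (0, c) _ (List.mem_flatMap.2 ⟨w, hw, List.mem_map_of_mem hκ⟩)
      simpa [hv] using this
    · intro k P hP c
      have := h6 (k, c) _ (List.mem_map_of_mem (a := P) (by simpa using hP))
      simpa using this
  · rintro ⟨h0, h1, h2, h3, h4, h5, h6⟩ ⟨k, c⟩ cl hcl
    simp only [clauses, List.mem_append] at hcl
    rcases hcl with (((((hcl | hcl) | hcl) | hcl) | hcl) | hcl) | hcl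
    · obtain rfl := List.mem_singleton.1 hcl
      simpa using h0
    · obtain ⟨a, ha, rfl⟩ := List.mem_map.1 hcl
      cases hv : v (Sum.inl a.1, c)
      · exact ⟨_, List.mem_cons_self, hv⟩
      · obtain ⟨e, he, hve⟩ := h1 a ha c hv
        exact ⟨_, List.mem_cons_of_mem _ (List.mem_map_of_mem he), hve⟩
    · obtain ⟨a, ha, rfl⟩ := List.mem_map.1 hcl
      cases hv : v (Sum.inl a.1, c)
      · exact ⟨_, List.mem_cons_self, hv⟩
      · exact ⟨_, List.mem_cons_of_mem _ (List.mem_singleton_self _),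
          Bool.eq_false_iff.2 (h2 a ha c hv)⟩
    · obtain ⟨s, -, rfl⟩ := List.mem_map.1 hcl
      cases hv : v (Sum.inl s, c)
      · exact ⟨_, List.mem_cons_self, hv⟩
      · obtain ⟨w, hw, hws, hvw⟩ := h3 s c hv
        exact ⟨_, List.mem_cons_of_mem _ (List.mem_flatMap.2 ⟨w, hw, by
          rw [if_pos hws]
          exact List.mem_singleton_self _⟩), hvw⟩
    · obtain ⟨e, he, hcl⟩ := List.mem_flatMap.1 hcl
      obtain ⟨w, hw, hcl⟩ := List.mem_flatMap.1 hcl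
      obtain ⟨w', hw', hcl⟩ := List.mem_flatMap.1 hcl
      split_ifs at hcl with hc
      · obtain rfl := List.mem_singleton.1 hcl
        cases hv : v (Sum.inr w, c)
        · exact ⟨_, List.mem_cons_self, hv⟩
        · exact ⟨_, List.mem_cons_of_mem _ (List.mem_singleton_self _), Bool.eq_false_iff.2
            fun hv' => hc.2.2 (h4 e he w hw w' hw' c hc.1 hc.2.1 hv hv')⟩
      · simp at hcl
    · obtain ⟨w, hw, hcl⟩ := List.mem_flatMap.1 hcl
      obtain ⟨κ, hκ, rfl⟩ := List.mem_map.1 hcl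
      cases hv : v (Sum.inr w, c)
      · exact ⟨_, List.mem_cons_self, hv⟩
      · exact ⟨_, List.mem_cons_of_mem _ (List.mem_singleton_self _), h5 w hw κ hκ c hv⟩
    · obtain ⟨P, hP, rfl⟩ := List.mem_map.1 hcl
      have := h6 k P (by simpa using hP) c
      simpa using this

theorem exists_forall_clauses_iff (T : List (WangTile n)) (F : ℕ → Option (PatternCode n)) :
    (∃ v : Var n → Bool, ∀ i : ℕ × Coord n, ∀ cl ∈ D.clauses T i.2 (F i.1),
      ∃ l ∈ cl, v l.1 = l.2) ↔ ∃ v, D.Satisfies T F v := by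
  classical
  simp only [forall_clauses_iff]
  exact ⟨fun ⟨v, h⟩ => ⟨_, h⟩, fun ⟨v, h⟩ => ⟨fun a => decide (v a), by simpa using h⟩⟩

end ClauseData

/-! ### Integer coordinates and vertex neighbours -/

section Coordinates

variable {n : ℕ} (S : ShapeSet n)

/-- The linear map sending integer coordinates to the point they describe. -/
noncomputable def pointHom : Coord n →ₗ[ℤ] Plane where
  toFun := point S
  map_add' c d := by
    simp only [point, ← Finset.sum_add_distrib]
    refine Finset.sum_congr rfl fun j _ => ?_
    simp only [Pi.add_apply, Prod.fst_add, Prod.snd_add]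
    module
  map_smul' m c := by
    simp only [point, Finset.smul_sum]
    refine Finset.sum_congr rfl fun j _ => ?_
    simp only [Pi.smul_apply, Prod.smul_fst, Prod.smul_snd, smul_add, smul_assoc, RingHom.id_apply]

theorem point_add (c d : Coord n) : point S (c + d) = point S c + point S d :=
  (pointHom S).map_add c d

theorem point_sub (c d : Coord n) : point S (c - d) = point S c - point S d :=
  (pointHom S).map_sub c d

theorem point_zero : point S 0 = 0 := (pointHom S).map_zero

theorem point_single (s : Fin n) (a b : ℤ) :
    point S (Pi.single s (a, b)) = a • (S s).u + b • (S s).v := by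
  rw [point, Finset.sum_eq_single s]
  · simp
  · intro j _ hj
    simp [Pi.single_eq_of_ne hj]
  · simp

/-- Integer coordinates of the vertices of a shape placed at the origin. -/
def vertexCoord (s : Fin n) : Fin 4 → Coord n :=
  ![0, Pi.single s (1, 0), Pi.single s (1, 1), Pi.single s (0, 1)]

theorem vertex_eq_add_point (t : PlacedShape n) (k : Fin 4) :
    vertex S t k = t.2 + point S (vertexCoord t.1 k) := by
  fin_cases k <;> simp [vertex, vertexCoord, point_single, point_zero, add_assoc]

/-- The displacements between two shapes with a common vertex. -/
def steps (n : ℕ) : Finset (Coord n) :=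
  Finset.univ.image fun q : (Fin n × Fin 4) × (Fin n × Fin 4) =>
    vertexCoord q.1.1 q.1.2 - vertexCoord q.2.1 q.2.2

/-- The shapes with displacement that have a common vertex with the shape `s` at the origin. -/
def neighbours (s : Fin n) : Finset (Fin n × Coord n) :=
  Finset.univ.image fun q : Fin 4 × (Fin n × Fin 4) =>
    (q.2.1, vertexCoord s q.1 - vertexCoord q.2.1 q.2.2)

theorem steps_of_neighbours {s : Fin n} {e : Fin n × Coord n} (he : e ∈ neighbours s) :
    e.2 ∈ steps n := by
  obtain ⟨q, -, rfl⟩ := Finset.mem_image.1 he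
  exact Finset.mem_image.2 ⟨((s, q.1), q.2), Finset.mem_univ _, rfl⟩

theorem shareVertex_iff_exists_neighbours (t t' : PlacedShape n) :
    ShareVertex S t t' ↔ ∃ e ∈ neighbours t.1, t' = (e.1, t.2 + point S e.2) := by
  constructor
  · rintro ⟨k, l, h⟩
    refine ⟨_, Finset.mem_image.2 ⟨(k, t'.1, l), Finset.mem_univ _, rfl⟩, Prod.ext rfl ?_⟩
    rw [vertex_eq_add_point, vertex_eq_add_point] at h
    simp only [point_sub]
    rw [← add_sub_assoc, h, add_sub_cancel_right]
  · rintro ⟨e, he, rfl⟩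
    obtain ⟨⟨k, s', l⟩, -, rfl⟩ := Finset.mem_image.1 he
    refine ⟨k, l, ?_⟩
    rw [vertex_eq_add_point, vertex_eq_add_point]
    simp only [point_sub]
    abel

/-- The relations between edge vectors form a subgroup of a finitely generated free abelian group,
so finitely many generators suffice to make a predicate depend only on the point described. -/
theorem exists_periods : ∃ G : Finset (Coord n), (∀ κ ∈ G, point S κ = 0) ∧
    ∀ p : Coord n → Prop, (∀ κ ∈ G, ∀ c, p c → p (c + κ)) →
      ∀ c d, point S c = point S d → p c → p d := by
  classical
  have hfg : (LinearMap.ker (pointHom S)).FG := IsNoetherian.noetherian _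
  rw [Submodule.fg_iff_addSubgroup_fg] at hfg
  obtain ⟨G, hG⟩ := hfg
  have hker : ∀ κ ∈ G, point S κ = 0 := fun κ hκ => by
    have : κ ∈ (LinearMap.ker (pointHom S)).toAddSubgroup := hG ▸ AddSubgroup.subset_closure hκ
    exact this
  -- Adding the opposites turns one-way invariance into an equivalence.
  refine ⟨G ∪ -G, fun κ hκ => ?_, fun p hp c d hcd hc => ?_⟩
  · rcases Finset.mem_union.1 hκ with h | h
    · exact hker κ h
    · have h1 := hker (-κ) (Finset.mem_neg'.1 h)
      have h2 : point S (-κ) = -point S κ := (pointHom S).map_neg κ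
      rwa [h2, neg_eq_zero] at h1
  · have hiff : ∀ κ ∈ AddSubgroup.closure (G : Set (Coord n)), ∀ c, p c ↔ p (c + κ) := by
      intro κ hκ
      induction hκ using AddSubgroup.closure_induction with
      | mem κ hκ =>
        intro c
        refine ⟨hp κ (Finset.mem_union_left _ hκ) c, fun h => ?_⟩
        have := hp (-κ) (Finset.mem_union_right _ (by simpa using hκ)) _ h
        simpa using this
      | zero => simp
      | add κ κ' _ _ h h' =>
        intro c
        rw [h c, h' (c + κ), add_assoc]
      | neg κ _ h =>
        intro c
        rw [h (c + -κ), neg_add_cancel_right]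
    have hmem : d - c ∈ AddSubgroup.closure (G : Set (Coord n)) := by
      rw [hG]
      change point S (d - c) = 0
      rw [point_sub, hcd, sub_self]
    have := (hiff _ hmem c).1 hc
    rwa [add_sub_cancel] at this

end Coordinates

/-! ### The finite geometric data of a shapeset -/

variable {n : ℕ} (S : ShapeSet n)

/-- The shape `s` at the origin is in the interior of the union of the tiles described by `N`. -/
def IsSurrounding (s : Fin n) (N : Finset (Fin n × Coord n)) : Prop :=
  support S (s, 0) ⊆ interior (⋃ e ∈ N, support S (e.1, point S e.2))

theorem isSurrounding_iff (s : Fin n) (N : Finset (Fin n × Coord n)) (p : Plane) :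
    IsSurrounding S s N ↔
      support S (s, p) ⊆ interior (⋃ e ∈ N, support S (e.1, p + point S e.2)) := by
  have h1 : support S (s, p) = Homeomorph.addRight p '' support S (s, 0) := by
    have := support_add S (s, 0) p
    rwa [zero_add] at this
  have h2 : (⋃ e ∈ N, support S (e.1, p + point S e.2)) =
      Homeomorph.addRight p '' ⋃ e ∈ N, support S (e.1, point S e.2) := by
    simp only [image_iUnion]
    refine iUnion₂_congr fun e _ => ?_
    have := support_add S (e.1, point S e.2) p
    rwa [add_comm] at this
  rw [h1, h2, ← Homeomorph.image_interior, image_subset_image_iff (Homeomorph.injective _)]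
  rfl

/-- Compactness of a tile gives a margin for each surrounding set; there are finitely many shapes
and sets of neighbours, so a common margin exists. -/
theorem exists_pos_of_isSurrounding : ∃ ε > 0, ∀ s, ∀ N ⊆ neighbours s, IsSurrounding S s N →
    ∀ p q r, p ∈ support S (s, r) → dist p q < ε → ∃ e ∈ N, q ∈ support S (e.1, r + point S e.2) := by
  have h : ∀ i : Σ s : Fin n, {N // N ∈ (neighbours s).powerset}, ∃ ε > 0,
      IsSurrounding S i.1 i.2 → Metric.thickening ε (support S (i.1, 0)) ⊆
        ⋃ e ∈ (i.2 : Finset (Fin n × Coord n)), support S (e.1, point S e.2) := by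
    intro i
    by_cases hi : IsSurrounding S i.1 i.2
    · obtain ⟨ε, hε, hsub⟩ :=
        (isCompact_support S (i.1, 0)).exists_thickening_subset_open isOpen_interior hi
      exact ⟨ε, hε, fun _ => hsub.trans interior_subset⟩
    · exact ⟨1, one_pos, fun h => absurd h hi⟩
  choose δ hδ hsub using h
  obtain ⟨ε, hε, hle⟩ := exists_pos_forall_le hδ
  refine ⟨ε, hε, fun s N hN hsur p q r hp hpq => ?_⟩
  have hshift : ∀ (s : Fin n) (a x : Plane), x ∈ support S (s, r + a) ↔
      x - r ∈ support S (s, a) := by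
    intro s a x
    have := support_add S (s, a) r
    rw [add_comm] at this
    rw [this]
    exact ⟨by rintro ⟨y, hy, rfl⟩; simpa using hy, fun h => ⟨_, h, sub_add_cancel x r⟩⟩
  have hp' : p - r ∈ support S (s, 0) := by rwa [← hshift, add_zero]
  have hq : q - r ∈ Metric.thickening (δ ⟨s, N, Finset.mem_powerset.2 hN⟩) (support S (s, 0)) :=
    Metric.mem_thickening_iff.2 ⟨_, hp', by
      rw [dist_comm, dist_sub_right]
      exact hpq.trans_le (hle _)⟩
  obtain ⟨e, he, hqe⟩ := mem_iUnion₂.1 (hsub ⟨s, N, Finset.mem_powerset.2 hN⟩ hsur hq)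
  exact ⟨e, he, (hshift _ _ _).2 hqe⟩

open Classical in
/-- The clauses that describe the tilings by the shapeset `S`. -/
noncomputable def clauseData : ClauseData n where
  forced :=
    -- If `N` does not surround `s`, some neighbour outside `N` must be present. Applied to the set
    -- of all neighbours present, this says that they surround `s`.
    ((List.finRange n).flatMap fun s =>
      ((Finset.filter (fun N => ¬ IsSurrounding S s N) (neighbours s).powerset).toList.map fun N =>
        (s, (neighbours s \ N).toList))) ++
    -- Invariance of the shape variables under periods, written as forced tiles.
    (List.finRange n).flatMap fun s => (exists_periods S).choose.toList.map fun κ => (s, [(s, κ)])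
  -- `6 • steps n` is the sixfold sumset: the displacements reached by the chains of length 6 needed
  -- in `exists_sheet`.
  excluded := ((Finset.univ ×ˢ Finset.univ ×ˢ (6 • steps n)).filter
    fun b : Fin n × Fin n × Coord n => ((b.1, 0) : PlacedShape n) ≠ (b.2.1, point S b.2.2) ∧
      ¬ MeetEdgeToEdge S (b.1, 0) (b.2.1, point S b.2.2)).toList
  glued := ((Finset.univ ×ˢ Finset.univ ×ˢ steps n).filter
    fun e : (Fin n × Fin 4) × (Fin n × Fin 4) × Coord n =>
      edge S (e.1.1, 0) e.1.2 = edge S (e.2.1.1, point S e.2.2) e.2.1.2).toList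
  periods := (exists_periods S).choose.toList

variable {S}

theorem mem_excluded_clauseData {b : Fin n × Fin n × Coord n} : b ∈ (clauseData S).excluded ↔
    b.2.2 ∈ 6 • steps n ∧ ((b.1, 0) : PlacedShape n) ≠ (b.2.1, point S b.2.2) ∧
      ¬ MeetEdgeToEdge S (b.1, 0) (b.2.1, point S b.2.2) := by
  simp [clauseData]

theorem mem_glued_clauseData {e : (Fin n × Fin 4) × (Fin n × Fin 4) × Coord n} :
    e ∈ (clauseData S).glued ↔ e.2.2 ∈ steps n ∧
      edge S (e.1.1, 0) e.1.2 = edge S (e.2.1.1, point S e.2.2) e.2.1.2 := by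
  simp [clauseData]

theorem point_eq_zero_of_mem_periods {κ : Coord n} (h : κ ∈ (clauseData S).periods) :
    point S κ = 0 :=
  (exists_periods S).choose_spec.1 κ (Finset.mem_toList.1 h)

theorem of_point_eq {p : Coord n → Prop} (hp : ∀ κ ∈ (clauseData S).periods, ∀ c, p c → p (c + κ))
    {c d : Coord n} (hcd : point S c = point S d) (hc : p c) : p d :=
  (exists_periods S).choose_spec.2 p (fun κ hκ => hp κ (Finset.mem_toList.2 hκ)) c d hcd hc

/-! ### From a tiling to an assignment -/

theorem exists_satisfies_of_domino {F : ℕ → Option (PatternCode n)} {T : List (WangTile n)}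
    (h : Domino S (avoiding S F) T) : ∃ v, (clauseData S).Satisfies T F v := by
  classical
  obtain ⟨x, ⟨hxT, -, hcol⟩, hx, hav⟩ := h
  have hx : IsTiling S (erase '' x) := hx
  -- Any tile may serve as origin; one covering the point 0 is available. Coordinates are then read
  -- relative to its position `p₀`.
  obtain ⟨⟨s₀, p₀⟩, h₀, -⟩ := mem_iUnion₂.1 (hx.1 ▸ mem_univ (0 : Plane) :
    (0 : Plane) ∈ setSupport S (erase '' x))
  refine ⟨fun a => a.1.elim (fun s => (s, p₀ + point S a.2) ∈ erase '' x)
    fun w => (w, p₀ + point S a.2) ∈ x, ?_, ?_, ?_, ?_, ?_, ?_, ?_⟩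
  · exact ⟨s₀, by simpa [point_zero] using h₀⟩
  · intro a ha c hc
    dsimp only [Sum.elim_inl] at hc ⊢
    rcases List.mem_append.1 ha with ha | ha
    · obtain ⟨s, -, ha⟩ := List.mem_flatMap.1 ha
      obtain ⟨N, hN, rfl⟩ := List.mem_map.1 ha
      obtain ⟨hN, hsur⟩ := Finset.mem_filter.1 (Finset.mem_toList.1 hN)
      by_contra! hno
      -- Were no tile outside `N` present, all vertex neighbours in the tiling would come from `N`,
      -- which would then surround the tile.
      refine hsur ((isSurrounding_iff S s N (p₀ + point S c)).2
        ((hx.support_subset_interior hc).trans (interior_mono ?_)))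
      refine iUnion₂_subset fun t' ht' => ?_
      obtain ⟨e, he, rfl⟩ := (shareVertex_iff_exists_neighbours S _ _).1 ht'.2
      by_cases heN : e ∈ N
      · exact subset_biUnion_of_mem (u := fun e : Fin n × Coord n =>
          support S (e.1, p₀ + point S c + point S e.2)) heN
      · refine absurd ht'.1 ?_
        have := hno e (by simp [he, heN])
        rwa [point_add, ← add_assoc] at this
    · obtain ⟨s, -, ha⟩ := List.mem_flatMap.1 ha
      obtain ⟨κ, hκ, rfl⟩ := List.mem_map.1 ha
      refine ⟨_, List.mem_singleton_self _, ?_⟩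
      rw [point_add, point_eq_zero_of_mem_periods hκ, add_zero]
      exact hc
  · intro b hb c hc hc'
    obtain ⟨-, hne, hmeet⟩ := mem_excluded_clauseData.1 hb
    refine hmeet ?_
    dsimp only [Sum.elim_inl] at hc hc'
    rw [← meetEdgeToEdge_add_iff S _ _ (p₀ + point S c)]
    have e1 : point S b.2.2 + (p₀ + point S c) = p₀ + point S (c + b.2.2) := by
      rw [point_add]; abel
    dsimp only
    rw [zero_add, e1]
    refine hx.2 hc hc' fun heq => hne ?_
    rw [Prod.mk.injEq] at heq ⊢
    refine ⟨heq.1, ?_⟩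
    have := heq.2
    rw [point_add, ← add_assoc, left_eq_add] at this
    exact this.symm
  · rintro s c ⟨⟨w, p⟩, hw, heq⟩
    obtain ⟨h1, h2⟩ := Prod.mk.inj heq
    dsimp only at h1 h2
    subst h2
    exact ⟨w, hxT _ hw, h1, hw⟩
  · intro e he w _ w' _ c hwe hwe' hc hc'
    obtain ⟨-, hedge⟩ := mem_glued_clauseData.1 he
    refine hcol _ hc _ hc' _ _ ?_
    have e1 : point S e.2.2 + (p₀ + point S c) = p₀ + point S (c + e.2.2) := by
      rw [point_add]; abel
    have h1 := edge_add S (e.1.1, 0) (p₀ + point S c) e.1.2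
    have h2 := edge_add S (e.2.1.1, point S e.2.2) (p₀ + point S c) e.2.1.2
    dsimp only at h1 h2
    rw [zero_add] at h1
    rw [e1] at h2
    dsimp only [erase]
    rw [hwe, hwe', h1, h2, hedge]
  · intro w _ κ hκ c hc
    dsimp only [Sum.elim_inr] at hc ⊢
    rwa [point_add, point_eq_zero_of_mem_periods hκ, add_zero]
  · intro k P hP c
    by_contra! hall
    refine hav k P hP ⟨p₀ + point S c, ?_⟩
    rintro t ⟨e, he, rfl⟩
    have := hall e he
    dsimp only [Sum.elim_inl] at this ⊢
    convert this using 2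
    rw [point_add]
    abel

/-! ### From an assignment to a tiling -/

section Completeness

variable {F : ℕ → Option (PatternCode n)} {T : List (WangTile n)} {v : Var n → Prop}

variable (S) in
/-- The placed shapes declared present by an assignment. -/
def placedShapes (v : Var n → Prop) : Set (PlacedShape n) :=
  {t | ∃ c, t.2 = point S c ∧ v (Sum.inl t.1, c)}

namespace ClauseData.Satisfies

theorem shape_of_point_eq (hv : (clauseData S).Satisfies T F v) {s : Fin n} {c d : Coord n}
    (hcd : point S c = point S d) (hc : v (Sum.inl s, c)) : v (Sum.inl s, d) := by
  refine of_point_eq (p := fun c => v (Sum.inl s, c)) (fun κ hκ c hc => ?_) hcd hc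
  obtain ⟨e, he, h⟩ := hv.forced (s, [(s, κ)]) (List.mem_append_right _
    (List.mem_flatMap.2 ⟨s, List.mem_finRange s, List.mem_map_of_mem hκ⟩)) c hc
  obtain rfl := List.mem_singleton.1 he
  exact h

theorem tile_of_point_eq (hv : (clauseData S).Satisfies T F v) {w : WangTile n} (hw : w ∈ T)
    {c d : Coord n} (hcd : point S c = point S d) (hc : v (Sum.inr w, c)) : v (Sum.inr w, d) :=
  of_point_eq (p := fun c => v (Sum.inr w, c)) (hv.periodic w hw) hcd hc

theorem mem_placedShapes (hv : (clauseData S).Satisfies T F v) {s : Fin n} {c : Coord n} :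
    (s, point S c) ∈ placedShapes S v ↔ v (Sum.inl s, c) :=
  ⟨fun ⟨_, hd, h⟩ => hv.shape_of_point_eq (Eq.symm hd) h, fun h => ⟨c, rfl, h⟩⟩

theorem isSurrounding (hv : (clauseData S).Satisfies T F v) [DecidablePred v]
    {s : Fin n} {c : Coord n} (hc : v (Sum.inl s, c)) :
    IsSurrounding S s ((neighbours s).filter fun e => v (Sum.inl e.1, c + e.2)) := by
  classical
  by_contra hsur
  obtain ⟨e, he, h⟩ := hv.forced (s, (neighbours s \ (neighbours s).filter
      fun e => v (Sum.inl e.1, c + e.2)).toList)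
    (List.mem_append_left _ (List.mem_flatMap.2 ⟨s, List.mem_finRange s, List.mem_map.2
      ⟨_, Finset.mem_toList.2 (Finset.mem_filter.2
        ⟨Finset.mem_powerset.2 (Finset.filter_subset _ _), hsur⟩), by congr!⟩⟩)) c hc
  simp only [Finset.mem_toList, Finset.mem_sdiff, Finset.mem_filter, not_and] at he
  exact he.2 he.1 h

variable (S v) in
/-- Two tiles declared present have a common vertex. -/
def Adj (t t' : placedShapes S v) : Prop := ShareVertex S (t : PlacedShape n) t'

instance : Std.Refl (Adj S v) := ⟨fun t => shareVertex_refl S t⟩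

instance : Std.Symm (Adj S v) := ⟨fun _ _ h => ShareVertex.symm h⟩

theorem exists_add_point_of_linked {k : ℕ} {t t' : placedShapes S v}
    (h : Linked (Adj S v) k t t') :
    ∃ d ∈ k • steps n, (t' : PlacedShape n).2 = (t : PlacedShape n).2 + point S d := by
  induction k generalizing t with
  | zero =>
    obtain rfl : t = t' := h
    exact ⟨0, by simp, by rw [point_zero, add_zero]⟩
  | succ k ih =>
    obtain ⟨u, htu, hut'⟩ := h
    obtain ⟨d, hd, hdt'⟩ := ih hut'
    obtain ⟨e, he, heu⟩ := (shareVertex_iff_exists_neighbours S _ _).1 htu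
    refine ⟨d + e.2, ?_, ?_⟩
    · rw [succ_nsmul]
      exact Finset.add_mem_add hd (steps_of_neighbours he)
    · rw [hdt', heu, point_add, add_comm (point S d), add_assoc]

/-- A chain of six steps yields one displacement in the sumset covered by `excluded`. The
coordinates witnessing `t'` may differ from those obtained along the chain, which is where
invariance under periods enters. -/
theorem meetEdgeToEdge_of_linked (hv : (clauseData S).Satisfies T F v) {t t' : placedShapes S v}
    (h : Linked (Adj S v) 6 t t') (hne : (t : PlacedShape n) ≠ t') :
    MeetEdgeToEdge S (t : PlacedShape n) t' := by
  obtain ⟨d, hd, hdt'⟩ := exists_add_point_of_linked h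
  obtain ⟨⟨s, p⟩, ht⟩ := t
  obtain ⟨⟨s', p'⟩, ht'⟩ := t'
  dsimp only at hdt' hne ⊢
  obtain ⟨c, hp, hc⟩ := ht
  obtain ⟨c', hp', hc'⟩ := ht'
  dsimp only at hp hc hp' hc'
  have hcd : v (Sum.inl s', c + d) :=
    hv.shape_of_point_eq (by rw [← hp', hdt', hp, point_add]) hc'
  by_contra hmeet
  refine hv.excluded (s, s', d) (mem_excluded_clauseData.2 ⟨hd, fun heq => hne ?_, fun h => ?_⟩)
    c hc hcd
  · rw [Prod.mk.injEq] at heq ⊢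
    exact ⟨heq.1, by rw [hdt', ← heq.2, add_zero]⟩
  · refine hmeet ?_
    rw [← meetEdgeToEdge_add_iff S _ _ p] at h
    dsimp only at h
    rwa [zero_add, add_comm (point S d), ← hdt'] at h

theorem exists_isTiling_subset (hv : (clauseData S).Satisfies T F v) :
    ∃ Y ⊆ placedShapes S v, IsTiling S Y := by
  classical
  obtain ⟨ε, hε, hcov⟩ := exists_pos_of_isSurrounding S
  obtain ⟨s₀, h₀⟩ := hv.origin
  obtain ⟨Y, hY, hYadj⟩ := exists_sheet (r := Adj S v) (ε := ε)
    (supp := fun t => support S (t : PlacedShape n)) hε (fun t => isPreconnected_support S _)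
    (by
      rintro ⟨⟨s, r⟩, c, hr, hc⟩ p q hp hpq
      dsimp only at hr hc hp
      subst hr
      obtain ⟨e, he, hq⟩ := hcov s _ (Finset.filter_subset _ _) (hv.isSurrounding hc) p q _ hp hpq
      obtain ⟨he, hve⟩ := Finset.mem_filter.1 he
      rw [← point_add] at hq
      refine ⟨⟨(e.1, point S (c + e.2)), _, rfl, hve⟩, ?_, hq⟩
      exact (shareVertex_iff_exists_neighbours S _ _).2 
        ⟨e, he, congrArg (Prod.mk e.1) (point_add S c e.2)⟩)
    (by
      intro t t' p h hp hp'
      by_cases heq : (t : PlacedShape n) = t'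
      · rw [Subtype.ext heq]
        exact refl _
      · exact (hv.meetEdgeToEdge_of_linked h heq).shareVertex hp hp')
    (t₀ := ⟨(s₀, point S 0), _, rfl, h₀⟩) ⟨_, position_mem_support S _⟩
  refine ⟨Subtype.val '' Y, by rintro _ ⟨t, -, rfl⟩; exact t.2, eq_univ_of_forall fun p => ?_, ?_⟩
  · obtain ⟨t, ht, hp⟩ := hY p
    exact mem_iUnion₂.2 ⟨t, ⟨t, ht, rfl⟩, hp⟩
  · rintro _ ⟨t, ht, rfl⟩ _ ⟨t', ht', rfl⟩ hne
    rcases eq_empty_or_nonempty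
      (support S (t : PlacedShape n) ∩ support S (t' : PlacedShape n)) with h | ⟨p, hp, hp'⟩
    · exact Or.inl h
    · exact hv.meetEdgeToEdge_of_linked
        ((Linked.one (hYadj t ht t' ht' p hp hp')).mono (by norm_num)) hne

/-- All positions declared present are integer combinations of edge vectors, so a translation
carrying one entry of the pattern onto such a position is itself one, and an avoidance clause
applies to it. -/
theorem not_appears (hv : (clauseData S).Satisfies T F v) {k : ℕ} {P : PatternCode n}
    (hP : P ∈ F k) : ¬ Appears (P.decode S) (placedShapes S v) := by
  rintro ⟨d, hd⟩
  -- The clause at 0 is used only to produce an entry of `P`.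
  obtain ⟨e₀, he₀, -⟩ := hv.avoids k P hP 0
  obtain ⟨c₀, hc₀, -⟩ := hd _ ⟨e₀, he₀, rfl⟩
  dsimp only at hc₀
  obtain ⟨e, he, hno⟩ := hv.avoids k P hP (c₀ - e₀.2)
  refine hno (hv.mem_placedShapes.1 ?_)
  have h := hd _ ⟨e, he, rfl⟩
  dsimp only at h
  have e1 : point S e.2 + d = point S (c₀ - e₀.2 + e.2) := by
    rw [point_add, point_sub, ← hc₀]
    abel
  rwa [e1] at h

theorem domino (hv : (clauseData S).Satisfies T F v) : Domino S (avoiding S F) T := by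
  obtain ⟨Y, hYsub, hY⟩ := hv.exists_isTiling_subset
  -- All tiles declared present over `Y` are kept, without choosing one per place: two of them at
  -- the same place share every side, so the glued clauses force equal colours.
  let x : Set (PlacedWangTile n) :=
    {t | t.1 ∈ T ∧ erase t ∈ Y ∧ ∃ c, t.2 = point S c ∧ v (Sum.inr t.1, c)}
  have hx : erase '' x = Y := by
    ext ⟨s, p⟩
    constructor
    · rintro ⟨t, ht, h⟩
      exact h ▸ ht.2.1
    · intro h
      obtain ⟨c, rfl, hc⟩ := hYsub h
      obtain ⟨w, hw, rfl, hwc⟩ := hv.coloured _ _ hc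
      exact ⟨(w, point S c), ⟨hw, h, c, rfl, hwc⟩, rfl⟩
  refine ⟨x, ⟨fun t ht => ht.1, by rw [hx]; exact hY, ?_⟩, ?_⟩
  · rintro ⟨w, p⟩ ⟨hw, -, c, hp, hc⟩ ⟨w', p'⟩ ⟨hw', -, c', hp', hc'⟩ k l hedge
    dsimp only at hw hp hc hw' hp' hc' ⊢
    subst hp hp'
    obtain ⟨e, he, heq⟩ := (shareVertex_iff_exists_neighbours S _ _).1
      (shareVertex_of_edge_eq hedge)
    obtain ⟨-, heq⟩ := Prod.mk.inj heq
    dsimp only [erase] at he heq hedge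
    refine hv.glued ((w.1, k), (w'.1, l), e.2)
      (mem_glued_clauseData.2 ⟨steps_of_neighbours he, ?_⟩) w hw w' hw' c rfl rfl hc
      (hv.tile_of_point_eq hw' (by rw [heq, point_add]) hc')
    have h1 := edge_add S (w.1, 0) (point S c) k
    have h2 := edge_add S (w'.1, point S e.2) (point S c) l
    dsimp only at h1 h2 ⊢
    rw [zero_add] at h1
    rw [add_comm, ← heq] at h2
    exact (add_left_injective (point S c)).image_injective (h1.symm.trans (hedge.trans h2))
  · rw [hx]
    exact ⟨hY, fun k P hP ⟨d, hd⟩ => hv.not_appears hP ⟨d, fun t ht => hYsub (hd t ht)⟩⟩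

end ClauseData.Satisfies

end Completeness

end RhombusTiling

theorem mainTheorem4 {n : ℕ} (S : RhombusTiling.ShapeSet n)
    (X : Set (Set (RhombusTiling.PlacedShape n)))
    (hX : RhombusTiling.IsEffectiveSubshift S X) :
    RhombusTiling.IsCoComputablyEnumerable (RhombusTiling.Domino S X) := by
  obtain ⟨F, hF, -, rfl⟩ := hX
  obtain ⟨f, hf, hfA⟩ :=
    (RhombusTiling.clauseData S).isCoComputablyEnumerable_exists_assignment F hF
  refine ⟨f, hf, fun T => ?_⟩
  refine Iff.trans ?_ (hfA T)
  refine Iff.trans ?_ (RhombusTiling.ClauseData.exists_forall_clauses_iff _ T F).symm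
  exact ⟨RhombusTiling.exists_satisfies_of_domino, fun ⟨_, hv⟩ => hv.domino⟩
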